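/- **Setting.** Let $M$ be a smooth $n$-dimensional manifold and let $D\subset TM$ be an open set of nonzero tangent vectors that is conic ($y\in D$, $c>0$ imply $cy\in D$). A *Finsler metric on $D$* is a smooth positive function $L:D\to\mathbb R$, positively homogeneous of degree one in $y$, whose fundamental tensor $g_{ij}=\partial_{y^i}\partial_{y^j}(L^2/2)$ is nondegenerate at every point of $D$. Put $l_i=\partial_{y^i}L$, $h_{ij}=g_{ij}-l_il_j$, $C_{ijk}=\tfrac12\partial_{y^k}g_{ij}$, $C^h_{ij}=g^{hk}C_{kij}$, $$G^i=\tfrac12 g^{ij}\Big(y^k\,\partial_{x^k}\partial_{y^j}\tfrac{L^2}{2}-\partial_{x^j}\tfrac{L^2}{2}\Big),\quad N^i_j=\partial_{y^j}G^i,\quad \delta_j=\partial_{x^j}-N^r_j\partial_{y^r},\quad F^i_{jk}=\tfrac12g^{ir}(\delta_jg_{rk}+\delta_kg_{rj}-\delta_rg_{jk}).$$ For a covector field $b_i(x,y)$ on $D$ let $b_{i|j}=\delta_jb_i-b_rF^r_{ij}$ and $b_i|_k=\partial_{y^k}b_i-b_rC^r_{ik}$ be its h- and v-covariant derivatives for the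 Cartan connection of $L$; for a scalar $f$ let $f_{|j}=\delta_jf$. A smooth covector field $b_i(x,y)$ on $D$ is an *h-vector* of $(M,L)$ if $b_i|_k=0$ and $L\,C^h_{ij}b_h=\rho\,h_{ij}$ for some scalar function $\rho$ on $D$ without zeros. A *geodesic* of $L$ is a $C^2$ curve $x(t)$ on an open interval whose velocity $y=dx/dt$ lies in $D$ and which satisfies $\frac{dy^i}{dt}+2G^i(x,y)=\frac{d^2s/dt^2}{ds/dt}\,y^i$ in all local coordinates, where $ds/dt=L(x,y)$. A change $L\to{}^*L$ of Finsler metrics on $D$ is *projective* if every geodesic of $L$ is a geodesic of ${}^*L$ and conversely. **Theorem 4.1.** Let $L$ be a Finsler metric on $D$, let $b_i$ be an h-vector of $(M,L)$, let $\beta=b_iy^i$, and suppose that the Kropina change ${}^*L=L^2/\beta$ is again a Finsler metric on $D$ (in particular $\beta>0$ on $D$). Then the change $L\to{}^*L$ is projective if and only if $$F_{i0}=\frac{\beta_0}{\beta}\,m_i\qquad\text{at every point of } D,$$ where $2F_{ij}=b_{i|j}-b_{j|i}$, $F_{i0}=F_{ij}y^j$, $\beta_0=\beta_{|j}y^j$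 and $m_i=b_i-\frac{\beta}{L}\,l_i$. -/

import Mathlib

open scoped Manifold ContDiff

noncomputable section

namespace KropinaChange

/-! ### Coordinate calculus

A local expression is a function of the position coordinates `x` and the direction coordinates `y`.
The definitions of this part are the classical coordinate formulas; `L` is a local expression of
the fundamental function. -/

/-- Coordinate space. -/
abbrev Coord (n : ℕ) : Type := EuclideanSpace ℝ (Fin n)

/-- Real functions of `(x, y)`. -/
abbrev LocalFun (n : ℕ) : Type := Coord n → Coord n → ℝ

variable {n : ℕ}

/-- The partial derivative `∂f/∂xⁱ`. -/
def dx (i : Fin n) (f : LocalFun n) : LocalFun n := fun x y =>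
  fderiv ℝ (fun u => f u y) x (EuclideanSpace.single i 1)

/-- The partial derivative `∂f/∂yⁱ`. -/
def dy (i : Fin n) (f : LocalFun n) : LocalFun n := fun x y =>
  fderiv ℝ (fun v => f x v) y (EuclideanSpace.single i 1)

/-- The energy `L² / 2`. -/
def energy (L : LocalFun n) : LocalFun n := fun x y => L x y ^ 2 / 2

/-- The fundamental tensor `g_ij = ∂²(L²/2) / ∂yⁱ∂yʲ`. -/
def metric (L : LocalFun n) (i j : Fin n) : LocalFun n := dy i (dy j (energy L))

/-- The matrix `(g_ij)` at `(x, y)`. -/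
def metricMatrix (L : LocalFun n) (x y : Coord n) : Matrix (Fin n) (Fin n) ℝ :=
  Matrix.of fun i j => metric L i j x y

/-- The inverse fundamental tensor `gⁱʲ`. -/
def metricInv (L : LocalFun n) (i j : Fin n) : LocalFun n := fun x y =>
  (metricMatrix L x y)⁻¹ i j

/-- The normalized supporting element `l_i = ∂L/∂yⁱ`. -/
def supp (L : LocalFun n) (i : Fin n) : LocalFun n := dy i L

/-- The angular metric tensor `h_ij = g_ij - l_i l_j`. -/
def angular (L : LocalFun n) (i j : Fin n) : LocalFun n := fun x y =>
  metric L i j x y - supp L i x y * supp L j x y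

/-- The Cartan tensor `C_ijk = (1/2) ∂g_ij/∂yᵏ`. -/
def cartanLower (L : LocalFun n) (i j k : Fin n) : LocalFun n := fun x y =>
  dy k (metric L i j) x y / 2

/-- The Cartan tensor with a raised index, `Cʰ_ij = gʰᵏ C_kij`. -/
def cartanTensor (L : LocalFun n) (h i j : Fin n) : LocalFun n := fun x y =>
  ∑ k, metricInv L h k x y * cartanLower L k i j x y

/-- The geodesic spray coefficients
`Gⁱ = (1/2) gⁱʲ (yᵏ ∂²(L²/2)/∂xᵏ∂yʲ - ∂(L²/2)/∂xʲ)`. -/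
def spray (L : LocalFun n) (i : Fin n) : LocalFun n := fun x y =>
  (1 / 2) * ∑ j, metricInv L i j x y *
    ((∑ k, y k * dx k (dy j (energy L)) x y) - dx j (energy L) x y)

/-- The nonlinear connection `Nⁱ_j = ∂Gⁱ/∂yʲ`. -/
def nonlinConn (L : LocalFun n) (i j : Fin n) : LocalFun n := dy j (spray L i)

/-- The horizontal derivative `δf/δxʲ = ∂f/∂xʲ - Nʳ_j ∂f/∂yʳ`;
on a scalar `f` it is the h-covariant derivative `f_{|j}`. -/
def horiz (L : LocalFun n) (j : Fin n) (f : LocalFun n) : LocalFun n := fun x y =>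
  dx j f x y - ∑ r, nonlinConn L r j x y * dy r f x y

/-- The horizontal coefficients of the Cartan connection,
`Fⁱ_jk = (1/2) gⁱʳ (δg_rk/δxʲ + δg_rj/δxᵏ - δg_jk/δxʳ)`. -/
def cartanConn (L : LocalFun n) (i j k : Fin n) : LocalFun n := fun x y =>
  (1 / 2) * ∑ r, metricInv L i r x y *
    (horiz L j (metric L r k) x y + horiz L k (metric L r j) x y - horiz L r (metric L j k) x y)

/-- The h-covariant derivative of a covector field, `b_{i|j} = δb_i/δxʲ - b_r Fʳ_ij`. -/
def hCov (L : LocalFun n) (b : Fin n → LocalFun n) (i j : Fin n) : LocalFun n := fun x y =>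
  horiz L j (b i) x y - ∑ r, b r x y * cartanConn L r i j x y

/-- The v-covariant derivative of a covector field, `b_i|_k = ∂b_i/∂yᵏ - b_r Cʳ_ik`. -/
def vCov (L : LocalFun n) (b : Fin n → LocalFun n) (i k : Fin n) : LocalFun n := fun x y =>
  dy k (b i) x y - ∑ r, b r x y * cartanTensor L r i k x y

/-- The tensor `F_ij`, where `2 F_ij = b_{i|j} - b_{j|i}`. -/
def skewF (L : LocalFun n) (b : Fin n → LocalFun n) (i j : Fin n) : LocalFun n := fun x y =>
  (hCov L b i j x y - hCov L b j i x y) / 2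

/-! ### Objects on the manifold -/

variable {M : Type*} [TopologicalSpace M] [ChartedSpace (EuclideanSpace ℝ (Fin n)) M]

/-- The tangent vector whose coordinates in the chart `e` are `(x, y)`. -/
def chartVec (e : OpenPartialHomeomorph M (EuclideanSpace ℝ (Fin n))) (x y : Coord n) :
    TangentBundle (𝓡 n) M :=
  tangentMap (𝓡 n) (𝓡 n) e.symm ⟨x, y⟩

/-- The coordinate expression of a function on the tangent bundle. -/
def coordFun (e : OpenPartialHomeomorph M (EuclideanSpace ℝ (Fin n)))
    (f : TangentBundle (𝓡 n) M → ℝ) : LocalFun n :=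
  fun x y => f (chartVec e x y)

/-- The components `b_i(x, y)` in the chart `e` of a covector field depending on direction. -/
def coordCovec (e : OpenPartialHomeomorph M (EuclideanSpace ℝ (Fin n)))
    (b : (p : TangentBundle (𝓡 n) M) → (TangentSpace (𝓡 n) p.proj →L[ℝ] ℝ)) (i : Fin n) :
    LocalFun n :=
  fun x y => b (chartVec e x y) (mfderiv (𝓡 n) (𝓡 n) e.symm x (EuclideanSpace.single i 1))

/-- The pairs `(x, y)` that are the coordinates in the chart `e` of a vector in `D`. -/
def coordDomain (e : OpenPartialHomeomorph M (EuclideanSpace ℝ (Fin n)))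
    (D : Set (TangentBundle (𝓡 n) M)) : Set (Coord n × Coord n) :=
  {q | q.1 ∈ e.target ∧ chartVec e q.1 q.2 ∈ D}

variable [IsManifold (𝓡 n) ∞ M]

/-- `L` is the fundamental function of a Finsler space with the open conic set `D` of nonzero
vectors as its set of admissible directions: it is smooth, positive and positively homogeneous of
degree one on `D`, and its fundamental tensor is nondegenerate there. -/
structure IsFinslerMetric (D : Set (TangentBundle (𝓡 n) M)) (L : TangentBundle (𝓡 n) M → ℝ) :
    Prop where
  isOpen : IsOpen D
  ne_zero : ∀ p ∈ D, p.snd ≠ 0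
  conic : ∀ p ∈ D, ∀ c : ℝ, 0 < c → (⟨p.proj, c • p.snd⟩ : TangentBundle (𝓡 n) M) ∈ D
  smooth : ContMDiffOn (𝓡 n).tangent 𝓘(ℝ, ℝ) ∞ L D
  pos : ∀ p ∈ D, 0 < L p
  homogeneous : ∀ p ∈ D, ∀ c : ℝ, 0 < c → L ⟨p.proj, c • p.snd⟩ = c * L p
  nondegenerate : ∀ e ∈ IsManifold.maximalAtlas (𝓡 n) ∞ M, ∀ x y, (x, y) ∈ coordDomain e D →
    (metricMatrix (coordFun e L) x y).det ≠ 0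

/-- `b` is an h-vector of `(M, L)`: a smooth covector field `b_i(x, y)` with `b_i|_k = 0` and
`L Cʰ_ij b_h = ρ h_ij` for a scalar function `ρ` without zeros. -/
structure IsHVector (D : Set (TangentBundle (𝓡 n) M)) (L : TangentBundle (𝓡 n) M → ℝ)
    (b : (p : TangentBundle (𝓡 n) M) → (TangentSpace (𝓡 n) p.proj →L[ℝ] ℝ)) : Prop where
  smooth : ∀ e ∈ IsManifold.maximalAtlas (𝓡 n) ∞ M, ∀ i,
    ContDiffOn ℝ ∞ (fun q : Coord n × Coord n => coordCovec e b i q.1 q.2) (coordDomain e D)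
  vParallel : ∀ e ∈ IsManifold.maximalAtlas (𝓡 n) ∞ M, ∀ x y, (x, y) ∈ coordDomain e D →
    ∀ i k, vCov (coordFun e L) (coordCovec e b) i k x y = 0
  exists_rho : ∃ ρ : TangentBundle (𝓡 n) M → ℝ, (∀ p ∈ D, ρ p ≠ 0) ∧
    ∀ e ∈ IsManifold.maximalAtlas (𝓡 n) ∞ M, ∀ x y, (x, y) ∈ coordDomain e D → ∀ i j,
      coordFun e L x y *
          ∑ h, cartanTensor (coordFun e L) h i j x y * coordCovec e b h x y =
        coordFun e ρ x y * angular (coordFun e L) i j x y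

/-- The function `β = b_i(x, y) yⁱ`. -/
def beta (b : (p : TangentBundle (𝓡 n) M) → (TangentSpace (𝓡 n) p.proj →L[ℝ] ℝ))
    (p : TangentBundle (𝓡 n) M) : ℝ := b p p.snd

/-- The Kropina change `*L = L² / β`. -/
def kropina (L : TangentBundle (𝓡 n) M → ℝ)
    (b : (p : TangentBundle (𝓡 n) M) → (TangentSpace (𝓡 n) p.proj →L[ℝ] ℝ))
    (p : TangentBundle (𝓡 n) M) : ℝ := L p ^ 2 / beta b p

/-- The covector `m_i = b_i - (β / L) l_i` in the chart `e`. -/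
def coordM (e : OpenPartialHomeomorph M (EuclideanSpace ℝ (Fin n)))
    (L : TangentBundle (𝓡 n) M → ℝ)
    (b : (p : TangentBundle (𝓡 n) M) → (TangentSpace (𝓡 n) p.proj →L[ℝ] ℝ)) (i : Fin n) :
    LocalFun n := fun x y =>
  coordCovec e b i x y -
    coordFun e (beta b) x y / coordFun e L x y * supp (coordFun e L) i x y

/-- The velocity of a curve, as a point of the tangent bundle. -/
def velocity (c : ℝ → M) (t : ℝ) : TangentBundle (𝓡 n) M :=
  tangentMap 𝓘(ℝ, ℝ) (𝓡 n) c ⟨t, (1 : ℝ)⟩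

/-- `c` is a geodesic of `L` on the set `J` of parameters, in an arbitrary regular
parametrization: its velocities are admissible and in all coordinates `xⁱ`, with `yⁱ = dxⁱ/dt`,
`dyⁱ/dt + 2 Gⁱ(x, y) = τ yⁱ` where `τ = (d²s/dt²) / (ds/dt)`
and `s` is the arc length, so that `ds/dt = L(x, y)`. -/
structure IsGeodesic (D : Set (TangentBundle (𝓡 n) M)) (L : TangentBundle (𝓡 n) M → ℝ)
    (c : ℝ → M) (J : Set ℝ) : Prop where
  smooth : ContMDiffOn 𝓘(ℝ, ℝ) (𝓡 n) 2 c J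
  admissible : ∀ t ∈ J, velocity c t ∈ D
  equation : ∀ e ∈ IsManifold.maximalAtlas (𝓡 n) ∞ M, ∀ t ∈ J, c t ∈ e.source → ∀ i,
    deriv (deriv fun r => e (c r)) t i +
        2 * spray (coordFun e L) i (e (c t)) (deriv (fun r => e (c r)) t) =
      deriv (fun r => L (velocity c r)) t / L (velocity c t) * deriv (fun r => e (c r)) t i

/-- The change `L → L'` of the metric is projective: the geodesics of `L` are geodesics of `L'`,
and conversely. -/
def IsProjectiveChange (D : Set (TangentBundle (𝓡 n) M)) (L L' : TangentBundle (𝓡 n) M → ℝ) :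
    Prop :=
  ∀ (c : ℝ → M) (J : Set ℝ), IsOpen J → J.OrdConnected →
    (IsGeodesic D L c J ↔ IsGeodesic D L' c J)

end KropinaChange

end

open scoped Manifold ContDiff

noncomputable section

namespace KropinaChange

open Filter Topology

section Calculus

variable {n : ℕ} {U : Set (Coord n × Coord n)} {f g : LocalFun n} {x y : Coord n}

/-! ### Partial derivatives and the total derivative -/

/-! Up to the choice of parameter, a geodesic of a Finsler metric is an extremal of its length, so
the geodesic equation can be traded for the Euler-Lagrange equation of `L` (`add_sprayVec_eq_iff`).
The trade is possible because L E_L + (DL) ∂L/∂y is the Euler-Lagrange expression of the energy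
L²/2, which is affine in the acceleration with linear part the nondegenerate tensor g and vanishes
at the acceleration -2G of the spray. Here D is the derivative along the curve. Since `L` has degree
one, E_L ignores multiples of y in the acceleration, and its solutions at (x, y) are exactly -2G +
ℝy.

If -2G also solves the equation of a second metric K at (x, y), the two solution lines are parallel
to y and share a point, hence coincide. Conversely, through each admissible vector passes a geodesic
of `L` (`exists_isGeodesic`, by Picard-Lindelöf for the spray), and if it is a geodesic of K, then
-2G solves the equation of K at that vector. So projectivity is the pointwise condition E_K(-2G) = 0
(`isProjectiveChange_iff`). Checking a geodesic in one chart is enough because E is a covector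
(`eulerLagrange_prolong`).

For the Kropina change, apply the product rule for E to Kβ = L² along the spray of `L`. There E_L =
0 and DL = 0, so E of L² vanishes. On the other side, the h-vector conditions make ∂b_i/∂yᵏ a
multiple of h_ik, which y annihilates. This gives ∂β/∂yⁱ = b_i (`dy_contraction`) and E_β = 2 F_{i0}
(`sum_skewF`), while Dβ = β_0 (`sum_horiz`). Eliminating DK and ∂K/∂yⁱ leaves β² E_K = -2L² (F_{i0}
- (β_0/β) m_i), and the equivalence follows since L and β are nonzero (`eulerLagrange_kropina_iff`).
-/

theorem sum_smul_single (v : Coord n) : ∑ i, v i • EuclideanSpace.single i (1 : ℝ) = v := by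
  ext j
  simp [Finset.sum_apply, Pi.single_apply]

theorem apply_eq_sum (T : Coord n →L[ℝ] ℝ) (v : Coord n) :
    T v = ∑ i, v i * T (EuclideanSpace.single i 1) := by
  conv_lhs => rw [← sum_smul_single v]
  simp [map_sum]

theorem apply_fst_eq_sum (T : Coord n × Coord n →L[ℝ] ℝ) (v : Coord n) :
    T (v, 0) = ∑ i, v i * T (EuclideanSpace.single i 1, 0) :=
  apply_eq_sum (T.comp (ContinuousLinearMap.inl ℝ _ _)) v

theorem apply_snd_eq_sum (T : Coord n × Coord n →L[ℝ] ℝ) (v : Coord n) :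
    T (0, v) = ∑ i, v i * T (0, EuclideanSpace.single i 1) :=
  apply_eq_sum (T.comp (ContinuousLinearMap.inr ℝ _ _)) v

theorem apply_eq_fst_add_snd (T : Coord n × Coord n →L[ℝ] ℝ) (v w : Coord n) :
    T (v, w) = T (v, 0) + T (0, w) := by
  rw [← map_add]; simp

theorem dx_eq_fderiv (hf : DifferentiableAt ℝ (Function.uncurry f) (x, y)) (i : Fin n) :
    dx i f x y = fderiv ℝ (Function.uncurry f) (x, y) (EuclideanSpace.single i 1, 0) := by
  have h := HasFDerivAt.comp (f := fun u => (u, y)) x hf.hasFDerivAt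
    (hasFDerivAt_prodMk_left x y)
  have h2 : HasFDerivAt (fun u => f u y) _ x := h
  rw [dx, h2.fderiv]; rfl

theorem dy_eq_fderiv (hf : DifferentiableAt ℝ (Function.uncurry f) (x, y)) (i : Fin n) :
    dy i f x y = fderiv ℝ (Function.uncurry f) (x, y) (0, EuclideanSpace.single i 1) := by
  have h := HasFDerivAt.comp (f := fun u => (x, u)) y hf.hasFDerivAt
    (hasFDerivAt_prodMk_right x y)
  have h2 : HasFDerivAt (fun u => f x u) _ y := h
  rw [dy, h2.fderiv]; rfl

theorem fderiv_fst_eq_sum (hf : DifferentiableAt ℝ (Function.uncurry f) (x, y)) (v : Coord n) :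
    fderiv ℝ (Function.uncurry f) (x, y) (v, 0) = ∑ i, v i * dx i f x y := by
  simp only [dx_eq_fderiv hf, ← apply_fst_eq_sum]

theorem fderiv_snd_eq_sum (hf : DifferentiableAt ℝ (Function.uncurry f) (x, y)) (v : Coord n) :
    fderiv ℝ (Function.uncurry f) (x, y) (0, v) = ∑ i, v i * dy i f x y := by
  simp only [dy_eq_fderiv hf, ← apply_snd_eq_sum]

/-- Identities between local expressions hold only on the admissible set. Openness of that set lets
them be differentiated. -/
theorem dx_congr (hU : IsOpen U) (hq : (x, y) ∈ U) (h : ∀ u v, (u, v) ∈ U → f u v = g u v)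
    (i : Fin n) : dx i f x y = dx i g x y := by
  have : (fun u => f u y) =ᶠ[𝓝 x] fun u => g u y := by
    have hc : ContinuousAt (fun u : Coord n => (u, y)) x := by fun_prop
    filter_upwards [hc.eventually (hU.mem_nhds hq)] with u hu using h _ _ hu
  rw [dx, dx, this.fderiv_eq]

theorem dy_congr (hU : IsOpen U) (hq : (x, y) ∈ U) (h : ∀ u v, (u, v) ∈ U → f u v = g u v)
    (i : Fin n) : dy i f x y = dy i g x y := by
  have : (fun u => f x u) =ᶠ[𝓝 y] fun u => g x u := by
    have hc : ContinuousAt (fun u : Coord n => (x, u)) y := by fun_prop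
    filter_upwards [hc.eventually (hU.mem_nhds hq)] with u hu using h _ _ hu
  rw [dy, dy, this.fderiv_eq]

/-- Smoothness of a local expression on a set of pairs `(x, y)`. -/
abbrev SmoothOn (U : Set (Coord n × Coord n)) (f : LocalFun n) : Prop :=
  ContDiffOn ℝ ∞ (Function.uncurry f) U

theorem SmoothOn.contDiffAt (hf : SmoothOn U f) (hU : IsOpen U) {q : Coord n × Coord n}
    (hq : q ∈ U) : ContDiffAt ℝ ∞ (Function.uncurry f) q :=
  ContDiffOn.contDiffAt hf (hU.mem_nhds hq)

theorem SmoothOn.differentiableAt (hf : SmoothOn U f) (hU : IsOpen U) {q : Coord n × Coord n}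
    (hq : q ∈ U) : DifferentiableAt ℝ (Function.uncurry f) q :=
  (hf.contDiffAt hU hq).differentiableAt (by simp)

theorem SmoothOn.fderiv (hf : SmoothOn U f) (hU : IsOpen U) :
    ContDiffOn ℝ ∞ (fderiv ℝ (Function.uncurry f)) U :=
  hf.fderiv_of_isOpen hU (by simp)

theorem SmoothOn.differentiableAt_fderiv (hf : SmoothOn U f) (hU : IsOpen U)
    {q : Coord n × Coord n} (hq : q ∈ U) :
    DifferentiableAt ℝ (_root_.fderiv ℝ (Function.uncurry f)) q :=
  ((hf.fderiv hU).contDiffAt (hU.mem_nhds hq)).differentiableAt (by simp)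

theorem SmoothOn.dx (hf : SmoothOn U f) (hU : IsOpen U) (i : Fin n) : SmoothOn U (dx i f) := by
  refine ((hf.fderiv hU).clm_apply
    (contDiffOn_const (c := (EuclideanSpace.single i 1, 0)))).congr fun q hq => ?_
  exact dx_eq_fderiv (hf.differentiableAt hU hq) i

theorem SmoothOn.dy (hf : SmoothOn U f) (hU : IsOpen U) (i : Fin n) : SmoothOn U (dy i f) := by
  refine ((hf.fderiv hU).clm_apply
    (contDiffOn_const (c := (0, EuclideanSpace.single i 1)))).congr fun q hq => ?_
  exact dy_eq_fderiv (hf.differentiableAt hU hq) i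

/-- The second derivative of a local expression in the pair `(x, y)`. -/
def hess (f : LocalFun n) (q u w : Coord n × Coord n) : ℝ :=
  fderiv ℝ (fderiv ℝ (Function.uncurry f)) q u w

theorem hess_symm (hf : SmoothOn U f) (hU : IsOpen U) {q : Coord n × Coord n} (hq : q ∈ U)
    (u w : Coord n × Coord n) : hess f q u w = hess f q w u :=
  (hf.contDiffAt hU hq).isSymmSndFDerivAt
    (by simpa using WithTop.coe_le_coe.2 (le_top (a := (2 : ℕ∞)))) u w

theorem hess_eq_fderiv_apply (hf : SmoothOn U f) (hU : IsOpen U) {q : Coord n × Coord n}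
    (hq : q ∈ U) (u w : Coord n × Coord n) :
    hess f q u w = fderiv ℝ (fun p => fderiv ℝ (Function.uncurry f) p w) q u := by
  have h := (hf.differentiableAt_fderiv hU hq).hasFDerivAt.clm_apply (hasFDerivAt_const w q)
  rw [h.fderiv]
  simp [hess]

theorem fderiv_dy (hf : SmoothOn U f) (hU : IsOpen U) {q : Coord n × Coord n}
    (hq : q ∈ U) (u : Coord n × Coord n) (j : Fin n) :
    fderiv ℝ (Function.uncurry (dy j f)) q u =
      hess f q u (0, EuclideanSpace.single j 1) := by
  rw [hess_eq_fderiv_apply hf hU hq]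
  congr 1
  refine Filter.EventuallyEq.fderiv_eq ?_
  filter_upwards [hU.mem_nhds hq] with p hp
  exact dy_eq_fderiv (hf.differentiableAt hU hp) j

theorem dy_dy (hf : SmoothOn U f) (hU : IsOpen U) (hq : (x, y) ∈ U) (i j : Fin n) :
    dy i (dy j f) x y =
      hess f (x, y) (0, EuclideanSpace.single i 1) (0, EuclideanSpace.single j 1) := by
  rw [dy_eq_fderiv ((hf.dy hU j).differentiableAt hU hq), fderiv_dy hf hU hq]

theorem hess_add_left (q u u' w : Coord n × Coord n) :
    hess f q (u + u') w = hess f q u w + hess f q u' w := by simp [hess]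

theorem hess_smul_left (q u w : Coord n × Coord n) (c : ℝ) :
    hess f q (c • u) w = c * hess f q u w := by simp [hess]

theorem hess_snd_add_left (q w : Coord n × Coord n) (u u' : Coord n) :
    hess f q (0, u + u') w = hess f q (0, u) w + hess f q (0, u') w := by
  rw [← hess_add_left]; simp

theorem hess_snd_smul_left (q w : Coord n × Coord n) (u : Coord n) (c : ℝ) :
    hess f q (0, c • u) w = c * hess f q (0, u) w := by
  rw [← hess_smul_left]; simp

/-- The Hessian of a product. -/
theorem hess_mul (hf : SmoothOn U f) (hg : SmoothOn U g) (hU : IsOpen U) {q : Coord n × Coord n}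
    (hq : q ∈ U) (u w : Coord n × Coord n) :
    hess (fun x y => f x y * g x y) q u w =
      f q.1 q.2 * hess g q u w + g q.1 q.2 * hess f q u w +
      fderiv ℝ (Function.uncurry f) q u * fderiv ℝ (Function.uncurry g) q w +
      fderiv ℝ (Function.uncurry g) q u * fderiv ℝ (Function.uncurry f) q w := by
  have h1 : fderiv ℝ (Function.uncurry fun x y => f x y * g x y) =ᶠ[𝓝 q] fun p =>
      Function.uncurry f p • fderiv ℝ (Function.uncurry g) p +
      Function.uncurry g p • fderiv ℝ (Function.uncurry f) p := by
    filter_upwards [hU.mem_nhds hq] with p hp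
    exact fderiv_mul (hf.differentiableAt hU hp) (hg.differentiableAt hU hp)
  have h2 := ((hf.differentiableAt hU hq).hasFDerivAt.smul
      (hg.differentiableAt_fderiv hU hq).hasFDerivAt).add
      ((hg.differentiableAt hU hq).hasFDerivAt.smul
      (hf.differentiableAt_fderiv hU hq).hasFDerivAt)
  have h3 := h1.fderiv_eq.trans (HasFDerivAt.fderiv h2)
  rw [hess, h3]
  simp [hess, Function.uncurry]
  ring

theorem fderiv_mul_uncurry (hf : SmoothOn U f) (hg : SmoothOn U g) (hU : IsOpen U)
    {q : Coord n × Coord n} (hq : q ∈ U) (w : Coord n × Coord n) :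
    fderiv ℝ (Function.uncurry fun x y => f x y * g x y) q w =
      f q.1 q.2 * fderiv ℝ (Function.uncurry g) q w +
      g q.1 q.2 * fderiv ℝ (Function.uncurry f) q w := by
  have := fderiv_mul (hf.differentiableAt hU hq) (hg.differentiableAt hU hq)
  change fderiv ℝ (Function.uncurry f * Function.uncurry g) q w = _
  rw [this]; simp [Function.uncurry]

/-! ### The Euler-Lagrange expression -/

/-- The Euler-Lagrange expression `d/dt (∂f/∂yʲ) vʲ - ∂f/∂xʲ vʲ` at `(x, y)`
with acceleration `a`. -/
def eulerLagrange (f : LocalFun n) (x y a v : Coord n) : ℝ :=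
  hess f (x, y) (y, a) (0, v) - fderiv ℝ (Function.uncurry f) (x, y) (v, 0)

theorem eulerLagrange_eq_sum (f : LocalFun n) (x y a v : Coord n) :
    eulerLagrange f x y a v =
      ∑ j, v j * eulerLagrange f x y a (EuclideanSpace.single j 1) := by
  simp only [eulerLagrange, mul_sub, Finset.sum_sub_distrib, hess, ← apply_fst_eq_sum,
    ← apply_snd_eq_sum]

theorem eulerLagrange_single (hf : SmoothOn U f) (hU : IsOpen U) (hq : (x, y) ∈ U)
    (a : Coord n) (j : Fin n) :
    eulerLagrange f x y a (EuclideanSpace.single j 1) =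
      ∑ k, y k * dx k (dy j f) x y + ∑ k, a k * dy k (dy j f) x y - dx j f x y := by
  have hd := (hf.dy hU j).differentiableAt hU hq
  rw [eulerLagrange, ← fderiv_dy hf hU hq, apply_eq_fst_add_snd, fderiv_fst_eq_sum hd,
    fderiv_snd_eq_sum hd, dx_eq_fderiv (hf.differentiableAt hU hq)]

/-- The acceleration enters only through the first argument of the Hessian, so the expression is
affine in it, with linear part the vertical Hessian. -/
theorem eulerLagrange_add (f : LocalFun n) (x y a a' v : Coord n) :
    eulerLagrange f x y (a + a') v = eulerLagrange f x y a v + hess f (x, y) (0, a') (0, v) := by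
  have : ((y, a + a') : Coord n × Coord n) = (y, a) + (0, a') := by simp
  rw [eulerLagrange, this, hess_add_left, eulerLagrange]; ring

/-- The cross terms come from d/dt acting on the other factor in ∂(fg)/∂y = f ∂g/∂y + g ∂f/∂y. -/
theorem eulerLagrange_mul (hf : SmoothOn U f) (hg : SmoothOn U g) (hU : IsOpen U)
    (hq : (x, y) ∈ U) (a v : Coord n) :
    eulerLagrange (fun x y => f x y * g x y) x y a v =
      f x y * eulerLagrange g x y a v + g x y * eulerLagrange f x y a v +
      fderiv ℝ (Function.uncurry f) (x, y) (y, a) * fderiv ℝ (Function.uncurry g) (x, y) (0, v) +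
      fderiv ℝ (Function.uncurry g) (x, y) (y, a) *
        fderiv ℝ (Function.uncurry f) (x, y) (0, v) := by
  rw [eulerLagrange, hess_mul hf hg hU hq, fderiv_mul_uncurry hf hg hU hq, eulerLagrange,
    eulerLagrange]
  ring

/-! ### Homogeneous functions -/

/-- Positive homogeneity of degree `k` in `y`. -/
def HomogeneousOn (U : Set (Coord n × Coord n)) (k : ℕ) (f : LocalFun n) : Prop :=
  ∀ x y, (x, y) ∈ U → ∀ c : ℝ, 0 < c → f x (c • y) = c ^ k * f x y

/-- `U` is invariant under positive rescaling of `y`. -/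
def Conic (U : Set (Coord n × Coord n)) : Prop :=
  ∀ x y, (x, y) ∈ U → ∀ c : ℝ, 0 < c → (x, c • y) ∈ U

theorem HomogeneousOn.euler {k : ℕ} (h : HomogeneousOn U k f)
    (hq : (x, y) ∈ U) (hf : DifferentiableAt ℝ (Function.uncurry f) (x, y)) :
    fderiv ℝ (Function.uncurry f) (x, y) (0, y) = k * f x y := by
  have hc : HasDerivAt (fun c : ℝ => ((x, c • y) : Coord n × Coord n)) (0, y) 1 := by
    have := (hasDerivAt_const (1 : ℝ) x).prodMk ((hasDerivAt_id (1 : ℝ)).smul_const y)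
    simpa using this
  have hf' : HasFDerivAt (Function.uncurry f) (fderiv ℝ (Function.uncurry f) (x, y))
      ((fun c : ℝ => ((x, c • y) : Coord n × Coord n)) 1) := by
    simpa using hf.hasFDerivAt
  have h1 := hf'.comp_hasDerivAt (1 : ℝ) hc
  have h2 : HasDerivAt (fun c : ℝ => c ^ k * f x y) (k * f x y) 1 := by
    simpa using (hasDerivAt_pow k (1 : ℝ)).mul_const (f x y)
  refine h1.unique (h2.congr_of_eventuallyEq ?_)
  filter_upwards [lt_mem_nhds (zero_lt_one (α := ℝ))] with c hc
  exact h x y hq c hc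

/-- Euler's identity differentiated in the direction `w`. The subtracted term appears because the
vector y in the identity moves with the base point. -/
theorem HomogeneousOn.hess_snd {k : ℕ} (h : HomogeneousOn U k f) (hU : IsOpen U)
    (hf : SmoothOn U f) (hq : (x, y) ∈ U) (w : Coord n × Coord n) :
    hess f (x, y) w (0, y) = k * fderiv ℝ (Function.uncurry f) (x, y) w -
      fderiv ℝ (Function.uncurry f) (x, y) (0, w.2) := by
  -- Euler's identity as an equality of functions of p, the direction (0, y) being the linear map p
  -- ↦ (0, p.2).
  have h1 : (fun p : Coord n × Coord n => fderiv ℝ (Function.uncurry f) p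
      (((ContinuousLinearMap.inr ℝ (Coord n) (Coord n)).comp
        (ContinuousLinearMap.snd ℝ (Coord n) (Coord n))) p)) =ᶠ[𝓝 (x, y)]
      fun p => (k : ℝ) * Function.uncurry f p := by
    filter_upwards [hU.mem_nhds hq] with p hp
    exact h.euler hp (hf.differentiableAt hU hp)
  have h2 := (hf.differentiableAt_fderiv hU hq).hasFDerivAt.clm_apply
    (((ContinuousLinearMap.inr ℝ (Coord n) (Coord n)).comp
        (ContinuousLinearMap.snd ℝ (Coord n) (Coord n))).hasFDerivAt (x := (x, y)))
  have h3 := (hf.differentiableAt hU hq).hasFDerivAt.const_mul (k : ℝ)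
  have h4 := congrArg (fun T => T w) (h2.fderiv.symm.trans (h1.fderiv_eq.trans h3.fderiv))
  simp at h4
  rw [hess]; linarith

theorem HomogeneousOn.eulerLagrange_self (h : HomogeneousOn U 1 f) (hU : IsOpen U)
    (hf : SmoothOn U f) (hq : (x, y) ∈ U) (a : Coord n) : eulerLagrange f x y a y = 0 := by
  rw [eulerLagrange, h.hess_snd hU hf hq, apply_eq_fst_add_snd _ y a]
  push_cast; ring

theorem HomogeneousOn.hess_snd_snd (h : HomogeneousOn U 1 f) (hU : IsOpen U)
    (hf : SmoothOn U f) (hq : (x, y) ∈ U) (v : Coord n) : hess f (x, y) (0, y) (0, v) = 0 := by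
  rw [hess_symm hf hU hq, h.hess_snd hU hf hq]
  push_cast; ring

/-- Invariance under reparametrization: a change of parameter alters the acceleration by a multiple
of y, which lies in the kernel of the vertical Hessian. -/
theorem HomogeneousOn.eulerLagrange_add_smul (h : HomogeneousOn U 1 f) (hU : IsOpen U)
    (hf : SmoothOn U f) (hq : (x, y) ∈ U) (a v : Coord n) (c : ℝ) :
    eulerLagrange f x y (a + c • y) v = eulerLagrange f x y a v := by
  rw [eulerLagrange_add, hess_snd_smul_left, h.hess_snd_snd hU hf hq]; ring

theorem HomogeneousOn.dx {k : ℕ} (h : HomogeneousOn U k f) (hU : IsOpen U) (i : Fin n)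
    (hf : SmoothOn U f) : HomogeneousOn U k (dx i f) := by
  intro x y hq c hc
  have h1 : (fun u => f u (c • y)) =ᶠ[𝓝 x] fun u => c ^ k * f u y := by
    have hc' : ContinuousAt (fun u : Coord n => (u, y)) x := by fun_prop
    filter_upwards [hc'.eventually (hU.mem_nhds hq)] with u hu using h _ _ hu c hc
  have h2 : DifferentiableAt ℝ (fun u => f u y) x :=
    DifferentiableAt.comp (f := fun u => (u, y)) x (hf.differentiableAt hU hq)
      (hasFDerivAt_prodMk_left x y).differentiableAt
  rw [KropinaChange.dx, h1.fderiv_eq, fderiv_const_mul h2]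
  rfl

theorem HomogeneousOn.dy {k : ℕ} (h : HomogeneousOn U (k + 1) f) (hU : IsOpen U)
    (hC : Conic U) (i : Fin n) (hf : SmoothOn U f) : HomogeneousOn U k (dy i f) := by
  intro x y hq c hc
  have h1 : (fun v => f x (c • v)) =ᶠ[𝓝 y] fun v => c ^ (k + 1) * f x v := by
    have hc' : ContinuousAt (fun u : Coord n => (x, u)) y := by fun_prop
    filter_upwards [hc'.eventually (hU.mem_nhds hq)] with u hu using h _ _ hu c hc
  have h2 : DifferentiableAt ℝ (fun v => f x v) y :=
    DifferentiableAt.comp (f := fun u => (x, u)) y (hf.differentiableAt hU hq)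
      (hasFDerivAt_prodMk_right x y).differentiableAt
  have h3 : DifferentiableAt ℝ (fun v => f x v) (c • y) :=
    DifferentiableAt.comp (f := fun u => (x, u)) (c • y)
      (hf.differentiableAt hU (hC _ _ hq c hc))
      (hasFDerivAt_prodMk_right x (c • y)).differentiableAt
  have h4 := (h3.hasFDerivAt.comp y ((hasFDerivAt_id y).const_smul c)).fderiv.symm.trans
    (h1.fderiv_eq.trans (h2.hasFDerivAt.const_mul (c ^ (k + 1))).fderiv)
  have h5 := congrArg (fun T => T (EuclideanSpace.single i (1 : ℝ))) h4
  simp only [ContinuousLinearMap.comp_apply, smul_apply, map_smul,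
    ContinuousLinearMap.id_apply, smul_eq_mul, pow_succ] at h5
  rw [KropinaChange.dy, KropinaChange.dy]
  -- The chain rule for v ↦ c • v produces an extra factor c, which accounts for the drop of degree
  -- by one.
  apply mul_left_cancel₀ hc.ne'
  rw [h5]; ring

end Calculus

/-! ### Finsler metrics in coordinates -/

theorem contDiffOn_det {m : ℕ} {V : Type*} [NormedAddCommGroup V] [NormedSpace ℝ V] {s : Set V}
    {A : V → Matrix (Fin m) (Fin m) ℝ} (h : ∀ i j, ContDiffOn ℝ ∞ (fun p => A p i j) s) :
    ContDiffOn ℝ ∞ (fun p => (A p).det) s := by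
  simp only [Matrix.det_apply]
  exact ContDiffOn.sum fun σ _ => ContDiffOn.const_smul _ (contDiffOn_prod fun i _ => h _ _)

/-- `L` is a Finsler metric on the open conic set `U` of pairs `(x, y)`. -/
structure IsLocalFinsler {n : ℕ} (U : Set (Coord n × Coord n)) (L : LocalFun n) : Prop where
  isOpen : IsOpen U
  conic : Conic U
  smooth : SmoothOn U L
  pos : ∀ x y, (x, y) ∈ U → 0 < L x y
  homogeneous : HomogeneousOn U 1 L
  nondegenerate : ∀ x y, (x, y) ∈ U → (metricMatrix L x y).det ≠ 0

/-- The spray coefficients as a vector. -/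
def sprayVec {n : ℕ} (L : LocalFun n) (x y : Coord n) : Coord n :=
  WithLp.toLp 2 fun i => spray L i x y

namespace IsLocalFinsler

variable {n : ℕ} {U : Set (Coord n × Coord n)} {L : LocalFun n} {x y : Coord n}

theorem smooth_energy (hL : IsLocalFinsler U L) : SmoothOn U (energy L) :=
  (ContDiffOn.pow hL.smooth 2).div_const 2

theorem homogeneous_energy (hL : IsLocalFinsler U L) : HomogeneousOn U 2 (energy L) := by
  intro x y hq c hc
  rw [energy, energy, hL.homogeneous x y hq c hc]; ring

theorem fderiv_energy (hL : IsLocalFinsler U L) {q : Coord n × Coord n} (hq : q ∈ U) :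
    fderiv ℝ (Function.uncurry (energy L)) q =
      Function.uncurry L q • fderiv ℝ (Function.uncurry L) q := by
  have h := ((hL.smooth.differentiableAt hL.isOpen hq).hasFDerivAt.pow 2).mul_const (2⁻¹ : ℝ)
  have h' : HasFDerivAt (Function.uncurry (energy L)) _ q :=
    h.congr_of_eventuallyEq (Eventually.of_forall fun p => by
      simp [energy, Function.uncurry, div_eq_mul_inv])
  rw [h'.fderiv]
  ext w <;> simp <;> ring

theorem hess_energy (hL : IsLocalFinsler U L) {q : Coord n × Coord n} (hq : q ∈ U)
    (u w : Coord n × Coord n) :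
    hess (energy L) q u w = L q.1 q.2 * hess L q u w +
      fderiv ℝ (Function.uncurry L) q u * fderiv ℝ (Function.uncurry L) q w := by
  have h1 : fderiv ℝ (Function.uncurry (energy L)) =ᶠ[𝓝 q] fun p =>
      Function.uncurry L p • fderiv ℝ (Function.uncurry L) p := by
    filter_upwards [hL.isOpen.mem_nhds hq] with p hp using hL.fderiv_energy hp
  have h2 := (hL.smooth.differentiableAt hL.isOpen hq).hasFDerivAt.smul
      (hL.smooth.differentiableAt_fderiv hL.isOpen hq).hasFDerivAt
  have h3 := h1.fderiv_eq.trans (HasFDerivAt.fderiv h2)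
  rw [hess, h3]
  simp [hess, Function.uncurry]

theorem eulerLagrange_energy (hL : IsLocalFinsler U L) (hq : (x, y) ∈ U) (a v : Coord n) :
    eulerLagrange (energy L) x y a v = L x y * eulerLagrange L x y a v +
      fderiv ℝ (Function.uncurry L) (x, y) (y, a) *
        fderiv ℝ (Function.uncurry L) (x, y) (0, v) := by
  rw [eulerLagrange, hL.hess_energy hq, hL.fderiv_energy hq, eulerLagrange]
  simp [Function.uncurry]; ring

/-! ### The fundamental tensor as vertical Hessian of the energy, and the spray -/

theorem metric_eq_hess (hL : IsLocalFinsler U L) (hq : (x, y) ∈ U) (i j : Fin n) :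
    metric L i j x y = hess (energy L) (x, y) (0, EuclideanSpace.single i 1)
      (0, EuclideanSpace.single j 1) :=
  dy_dy hL.smooth_energy hL.isOpen hq i j

theorem metric_symm (hL : IsLocalFinsler U L) (hq : (x, y) ∈ U) (i j : Fin n) :
    metric L i j x y = metric L j i x y := by
  rw [hL.metric_eq_hess hq, hL.metric_eq_hess hq, hess_symm hL.smooth_energy hL.isOpen hq]

theorem hess_energy_eq_sum (hL : IsLocalFinsler U L) (hq : (x, y) ∈ U) (w : Coord n)
    (j : Fin n) :
    hess (energy L) (x, y) (0, w) (0, EuclideanSpace.single j 1) =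
      ∑ i, metric L j i x y * w i := by
  rw [hess_symm hL.smooth_energy hL.isOpen hq, hess, apply_snd_eq_sum]
  refine Finset.sum_congr rfl fun i _ => ?_
  rw [hL.metric_eq_hess hq, hess, mul_comm]

theorem eq_zero_of_hess_energy (hL : IsLocalFinsler U L) (hq : (x, y) ∈ U) {w : Coord n}
    (h : ∀ v, hess (energy L) (x, y) (0, w) (0, v) = 0) : w = 0 := by
  have h1 : (metricMatrix L x y).mulVec w.ofLp = 0 := by
    ext j
    have := h (EuclideanSpace.single j 1)
    rw [hL.hess_energy_eq_sum hq] at this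
    simpa [Matrix.mulVec, dotProduct, metricMatrix] using this
  have h2 := Matrix.eq_zero_of_mulVec_eq_zero (hL.nondegenerate x y hq) h1
  ext i; simpa using congrFun h2 i

/-- The definition of the spray with its index lowered: multiplying by g cancels the inverse matrix,
which leaves an identity free of inverses. -/
theorem hess_energy_sprayVec (hL : IsLocalFinsler U L) (hq : (x, y) ∈ U) (v : Coord n) :
    hess (energy L) (x, y) (0, sprayVec L x y) (0, v) =
      (1 / 2) * (hess (energy L) (x, y) (y, 0) (0, v) -
        fderiv ℝ (Function.uncurry (energy L)) (x, y) (v, 0)) := by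
  have key : ∀ j, hess (energy L) (x, y) (0, sprayVec L x y) (0, EuclideanSpace.single j 1) =
      (1 / 2) * (hess (energy L) (x, y) (y, 0) (0, EuclideanSpace.single j 1) -
        fderiv ℝ (Function.uncurry (energy L)) (x, y) (EuclideanSpace.single j 1, 0)) := by
    intro j
    have hE := hL.smooth_energy
    set R : Fin n → ℝ := fun j => (∑ k, y k * dx k (dy j (energy L)) x y) - dx j (energy L) x y
      with hR
    have h1 : (sprayVec L x y).ofLp = (1 / 2 : ℝ) • (metricMatrix L x y)⁻¹.mulVec R := by
      ext i
      simp [sprayVec, spray, Matrix.mulVec, dotProduct, metricInv, hR]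
    have h2 : (metricMatrix L x y).mulVec (sprayVec L x y).ofLp = (1 / 2 : ℝ) • R := by
      rw [h1, Matrix.mulVec_smul, Matrix.mulVec_mulVec,
        Matrix.mul_nonsing_inv _ (hL.nondegenerate x y hq).isUnit, Matrix.one_mulVec]
    have h3 := congrFun h2 j
    rw [hL.hess_energy_eq_sum hq, ← fderiv_dy hE hL.isOpen hq,
      fderiv_fst_eq_sum ((hE.dy hL.isOpen j).differentiableAt hL.isOpen hq),
      ← dx_eq_fderiv (hE.differentiableAt hL.isOpen hq)]
    simpa [Matrix.mulVec, dotProduct, metricMatrix, hR] using h3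
  simp only [hess] at key ⊢
  rw [apply_snd_eq_sum, apply_snd_eq_sum _ v, apply_fst_eq_sum _ v, ← Finset.sum_sub_distrib,
    Finset.mul_sum]
  refine Finset.sum_congr rfl fun j _ => ?_
  rw [key]; ring

/-- The factor -2 cancels the 1/2 in the spray, so -2G is the acceleration of the extremals of the
energy. -/
theorem eulerLagrange_energy_sprayVec (hL : IsLocalFinsler U L) (hq : (x, y) ∈ U)
    (v : Coord n) : eulerLagrange (energy L) x y (-(2 : ℝ) • sprayVec L x y) v = 0 := by
  rw [← zero_add (-(2 : ℝ) • sprayVec L x y), eulerLagrange_add, hess_snd_smul_left,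
    hL.hess_energy_sprayVec hq, eulerLagrange]
  ring

/-- The derivative of `L` along its spray vanishes. -/
theorem fderiv_sprayVec (hL : IsLocalFinsler U L) (hq : (x, y) ∈ U) :
    fderiv ℝ (Function.uncurry L) (x, y) (y, -(2 : ℝ) • sprayVec L x y) = 0 := by
  -- Testing with v = y kills the Euler-Lagrange term of `L` and leaves (DL) L = 0.
  have h := hL.eulerLagrange_energy_sprayVec hq y
  rw [hL.eulerLagrange_energy hq, hL.homogeneous.eulerLagrange_self hL.isOpen hL.smooth hq,
    hL.homogeneous.euler hq (hL.smooth.differentiableAt hL.isOpen hq)] at h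
  simpa [(hL.pos x y hq).ne'] using h

theorem eulerLagrange_sprayVec (hL : IsLocalFinsler U L) (hq : (x, y) ∈ U) (v : Coord n) :
    eulerLagrange L x y (-(2 : ℝ) • sprayVec L x y) v = 0 := by
  have h := hL.eulerLagrange_energy_sprayVec hq v
  rw [hL.eulerLagrange_energy hq, hL.fderiv_sprayVec hq] at h
  simpa [(hL.pos x y hq).ne'] using h

theorem hess_energy_self (hL : IsLocalFinsler U L) (hq : (x, y) ∈ U) (v : Coord n) :
    hess (energy L) (x, y) (0, y) (0, v) =
      L x y * fderiv ℝ (Function.uncurry L) (x, y) (0, v) := by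
  rw [hess_symm hL.smooth_energy hL.isOpen hq,
    hL.homogeneous_energy.hess_snd hL.isOpen hL.smooth_energy hq, hL.fderiv_energy hq]
  simp [Function.uncurry]; ring

/-- The geodesic equation is the Euler-Lagrange equation of `L`. -/
theorem add_sprayVec_eq_iff (hL : IsLocalFinsler U L) (hq : (x, y) ∈ U) (a : Coord n) :
    a + (2 : ℝ) • sprayVec L x y =
        (fderiv ℝ (Function.uncurry L) (x, y) (y, a) / L x y) • y ↔
      ∀ v, eulerLagrange L x y a v = 0 := by
  have hpos := (hL.pos x y hq).ne'
  -- The defect of the geodesic equation, lowered with g, is L times the Euler-Lagrange covector: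
  -- the energy contributes g(a + 2G, ·), and the extra (DL) ∂L/∂y equals g((DL/L) y, ·).
  -- Nondegeneracy of g then gives the equivalence.
  have h1 : ∀ v, L x y * eulerLagrange L x y a v = hess (energy L) (x, y)
      (0, a + (2 : ℝ) • sprayVec L x y -
        (fderiv ℝ (Function.uncurry L) (x, y) (y, a) / L x y) • y) (0, v) := by
    intro v
    have h2 := hL.eulerLagrange_energy hq a v
    have h3 := eulerLagrange_add (energy L) x y (-(2 : ℝ) • sprayVec L x y)
      (a + (2 : ℝ) • sprayVec L x y) v
    rw [hL.eulerLagrange_energy_sprayVec hq,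
      show -(2 : ℝ) • sprayVec L x y + (a + (2 : ℝ) • sprayVec L x y) = a by module] at h3
    rw [sub_eq_add_neg, ← neg_smul, hess_snd_add_left, hess_snd_smul_left, hL.hess_energy_self hq]
    field_simp
    linarith
  constructor
  · intro h v
    have := h1 v
    rw [sub_eq_zero.2 h] at this
    simpa [hess, hpos, Prod.mk_zero_zero] using this
  · intro h
    refine sub_eq_zero.1 (hL.eq_zero_of_hess_energy hq fun v => ?_)
    rw [← h1, h, mul_zero]

/-- Extremal accelerations form the line through -2G parallel to y; its direction is the same for
every metric, which is why one common point suffices for projectivity. -/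
theorem eulerLagrange_eq_zero_iff (hL : IsLocalFinsler U L) (hq : (x, y) ∈ U) (a : Coord n) :
    (∀ v, eulerLagrange L x y a v = 0) ↔ ∃ c : ℝ, a = -(2 : ℝ) • sprayVec L x y + c • y := by
  constructor
  · intro h
    exact ⟨_, by rw [← (hL.add_sprayVec_eq_iff hq a).2 h]; module⟩
  · rintro ⟨c, rfl⟩ v
    rw [hL.homogeneous.eulerLagrange_add_smul hL.isOpen hL.smooth hq,
      hL.eulerLagrange_sprayVec hq]

/-- If the spray of `L` solves the Euler-Lagrange equation of `K` at `(x, y)`, then `L` and `K`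
have the same extremal accelerations there. -/
theorem eulerLagrange_iff_of_sprayVec {K : LocalFun n} (hL : IsLocalFinsler U L)
    (hK : IsLocalFinsler U K) (hq : (x, y) ∈ U)
    (h : ∀ v, eulerLagrange K x y (-(2 : ℝ) • sprayVec L x y) v = 0) (a : Coord n) :
    (∀ v, eulerLagrange L x y a v = 0) ↔ ∀ v, eulerLagrange K x y a v = 0 := by
  obtain ⟨d, hd⟩ := (hK.eulerLagrange_eq_zero_iff hq _).1 h
  rw [hL.eulerLagrange_eq_zero_iff hq, hK.eulerLagrange_eq_zero_iff hq, hd]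
  constructor
  · rintro ⟨c, rfl⟩
    exact ⟨d + c, by module⟩
  · rintro ⟨c, rfl⟩
    exact ⟨c - d, by module⟩

/-! ### Regularity and homogeneity of the spray -/

theorem smooth_metric (hL : IsLocalFinsler U L) (i j : Fin n) : SmoothOn U (metric L i j) :=
  (hL.smooth_energy.dy hL.isOpen j).dy hL.isOpen i

theorem homogeneous_metricMatrix (hL : IsLocalFinsler U L) (hq : (x, y) ∈ U) {c : ℝ}
    (hc : 0 < c) : metricMatrix L x (c • y) = metricMatrix L x y := by
  ext i j
  have h1 : HomogeneousOn U 1 (dy j (energy L)) :=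
    hL.homogeneous_energy.dy hL.isOpen hL.conic j hL.smooth_energy
  have h2 : HomogeneousOn U 0 (metric L i j) :=
    h1.dy hL.isOpen hL.conic i (hL.smooth_energy.dy hL.isOpen j)
  simpa [metricMatrix] using h2 x y hq c hc

theorem homogeneous_spray (hL : IsLocalFinsler U L) (i : Fin n) :
    HomogeneousOn U 2 (spray L i) := by
  intro x y hq c hc
  have hE := hL.smooth_energy
  have h1 : ∀ j, HomogeneousOn U 1 (dy j (energy L)) := fun j =>
    hL.homogeneous_energy.dy hL.isOpen hL.conic j hE
  simp only [spray, metricInv, hL.homogeneous_metricMatrix hq hc]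
  rw [mul_left_comm, Finset.mul_sum _ _ (c ^ 2)]
  congr 1
  refine Finset.sum_congr rfl fun j _ => ?_
  rw [hL.homogeneous_energy.dx hL.isOpen j hE x y hq c hc, mul_left_comm, mul_sub (c ^ 2),
    Finset.mul_sum _ _ (c ^ 2)]
  congr 2
  refine Finset.sum_congr rfl fun k _ => ?_
  rw [(h1 j).dx hL.isOpen k (hE.dy hL.isOpen j) x y hq c hc]
  simp; ring

/-- By Cramer's rule the inverse is the adjugate over the determinant, both polynomial in the g_ij,
with nonvanishing denominator. -/
theorem smooth_metricInv (hL : IsLocalFinsler U L) (i j : Fin n) :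
    SmoothOn U (metricInv L i j) := by
  have h1 : ∀ i j, ContDiffOn ℝ ∞
      (fun p : Coord n × Coord n => metricMatrix L p.1 p.2 i j) U := hL.smooth_metric
  have h2 : ContDiffOn ℝ ∞ (fun p : Coord n × Coord n => (metricMatrix L p.1 p.2).det⁻¹) U :=
    (contDiffOn_det h1).inv fun p hp => hL.nondegenerate _ _ hp
  have h3 : ContDiffOn ℝ ∞
      (fun p : Coord n × Coord n => (metricMatrix L p.1 p.2).adjugate i j) U := by
    simp only [Matrix.adjugate_apply]
    refine contDiffOn_det fun k l => ?_
    simp only [Matrix.updateRow_apply]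
    split_ifs
    · exact contDiffOn_const
    · exact h1 k l
  refine (h2.mul h3).congr fun p _ => ?_
  simp [Function.uncurry, metricInv, Matrix.inv_def, Ring.inverse_eq_inv']

theorem smooth_spray (hL : IsLocalFinsler U L) (i : Fin n) : SmoothOn U (spray L i) := by
  have hE := hL.smooth_energy
  refine contDiffOn_const.mul (ContDiffOn.sum fun j _ => (hL.smooth_metricInv i j).mul
    ((ContDiffOn.sum fun k _ => ?_).sub (hE.dx hL.isOpen j)))
  refine ContDiffOn.mul (ContDiff.contDiffOn ?_) ((hE.dy hL.isOpen j).dx hL.isOpen k)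
  fun_prop

theorem smooth_sprayVec (hL : IsLocalFinsler U L) :
    ContDiffOn ℝ ∞ (fun p : Coord n × Coord n => sprayVec L p.1 p.2) U :=
  contDiffOn_piLp' (p := 2) fun i => hL.smooth_spray i

/-- Euler's relation `Nⁱ_j yʲ = 2 Gⁱ`. -/
theorem sum_nonlinConn (hL : IsLocalFinsler U L) (hq : (x, y) ∈ U) (i : Fin n) :
    ∑ j, nonlinConn L i j x y * y j = 2 * spray L i x y := by
  have hd := (hL.smooth_spray i).differentiableAt hL.isOpen hq
  have h := (hL.homogeneous_spray i).euler hq hd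
  rw [fderiv_snd_eq_sum hd] at h
  simpa [nonlinConn, mul_comm] using h

end IsLocalFinsler

/-! ### h-vectors and the Kropina change in coordinates -/

/-- The coordinate conditions on an h-vector of `L`. -/
structure IsLocalHVector {n : ℕ} (U : Set (Coord n × Coord n)) (L : LocalFun n)
    (b : Fin n → LocalFun n) : Prop where
  smooth : ∀ i, SmoothOn U (b i)
  vParallel : ∀ x y, (x, y) ∈ U → ∀ i k, vCov L b i k x y = 0
  exists_rho : ∃ ρ : LocalFun n, ∀ x y, (x, y) ∈ U → ∀ i j,
    L x y * ∑ h, cartanTensor L h i j x y * b h x y = ρ x y * angular L i j x y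

/-- The function `b_i yⁱ`. -/
def contraction {n : ℕ} (b : Fin n → LocalFun n) : LocalFun n := fun x y => ∑ i, b i x y * y i

section Kropina

variable {n : ℕ} {U : Set (Coord n × Coord n)} {L K : LocalFun n} {b : Fin n → LocalFun n}
  {x y : Coord n}

/-! ### Contractions with the supporting vector y -/

/-- Both g_ik yⁱ and (l_i yⁱ) l_k equal L l_k, by Euler's relations for the energy and for `L`. -/
theorem IsLocalFinsler.sum_angular (hL : IsLocalFinsler U L) (hq : (x, y) ∈ U) (k : Fin n) :
    ∑ i, y i * angular L i k x y = 0 := by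
  have hd := hL.smooth.differentiableAt hL.isOpen hq
  have h1 : ∑ i, metric L k i x y * y i = L x y * supp L k x y := by
    rw [← hL.hess_energy_eq_sum hq, hL.hess_energy_self hq, supp, dy_eq_fderiv hd]
  have h2 : ∑ i, y i * supp L i x y = L x y := by
    simp only [supp]
    rw [← fderiv_snd_eq_sum hd, hL.homogeneous.euler hq hd]; simp
  calc ∑ i, y i * angular L i k x y
      = ∑ i, (metric L k i x y * y i - y i * supp L i x y * supp L k x y) :=
        Finset.sum_congr rfl fun i _ => by rw [angular, hL.metric_symm hq]; ring
    _ = 0 := by rw [Finset.sum_sub_distrib, ← Finset.sum_mul, h1, h2]; ring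

theorem IsLocalFinsler.cartanConn_symm (hL : IsLocalFinsler U L) (hq : (x, y) ∈ U)
    (i j k : Fin n) : cartanConn L i j k x y = cartanConn L i k j x y := by
  have h : ∀ r, horiz L r (metric L j k) x y = horiz L r (metric L k j) x y := by
    intro r
    have hm : ∀ u v, (u, v) ∈ U → metric L j k u v = metric L k j u v :=
      fun u v h => hL.metric_symm h j k
    simp only [horiz, dx_congr hL.isOpen hq hm, dy_congr hL.isOpen hq hm]
  simp only [cartanConn, h]
  congr 1
  exact Finset.sum_congr rfl fun r _ => by ring

/-- Since Nʳ_j yʲ = 2Gʳ, contracting the horizontal derivative with y gives the derivative along the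
spray. This is how β_0 enters. -/
theorem IsLocalFinsler.sum_horiz (hL : IsLocalFinsler U L) (hq : (x, y) ∈ U) {f : LocalFun n}
    (hf : SmoothOn U f) :
    ∑ j, horiz L j f x y * y j =
      fderiv ℝ (Function.uncurry f) (x, y) (y, -(2 : ℝ) • sprayVec L x y) := by
  have hd := hf.differentiableAt hL.isOpen hq
  rw [apply_eq_fst_add_snd, fderiv_fst_eq_sum hd, fderiv_snd_eq_sum hd]
  simp only [horiz, sub_mul, Finset.sum_sub_distrib, Finset.sum_mul]
  rw [Finset.sum_comm, sub_eq_add_neg, ← Finset.sum_neg_distrib]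
  congr 1
  · exact Finset.sum_congr rfl fun j _ => mul_comm _ _
  · refine Finset.sum_congr rfl fun r _ => ?_
    rw [show ∑ j, nonlinConn L r j x y * dy r f x y * y j =
      (∑ j, nonlinConn L r j x y * y j) * dy r f x y by
        rw [Finset.sum_mul]; exact Finset.sum_congr rfl fun j _ => by ring,
      hL.sum_nonlinConn hq]
    simp [sprayVec]

namespace IsLocalHVector

/-! ### Consequences of the h-vector conditions -/

/-- The two h-vector conditions combine to L ∂b_i/∂yᵏ = ρ h_ik, and h annihilates y. -/
theorem sum_dy (hb : IsLocalHVector U L b) (hL : IsLocalFinsler U L) (hq : (x, y) ∈ U)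
    (k : Fin n) : ∑ i, y i * dy k (b i) x y = 0 := by
  obtain ⟨ρ, hρ⟩ := hb.exists_rho
  have hpos := (hL.pos x y hq).ne'
  have h1 : ∀ i, L x y * dy k (b i) x y = ρ x y * angular L i k x y := by
    intro i
    rw [← hρ x y hq i k, sub_eq_zero.1 (hb.vParallel x y hq i k)]
    congr 1
    exact Finset.sum_congr rfl fun r _ => mul_comm _ _
  apply mul_left_cancel₀ hpos
  calc L x y * ∑ i, y i * dy k (b i) x y
      = ρ x y * ∑ i, y i * angular L i k x y := by
        rw [Finset.mul_sum, Finset.mul_sum]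
        refine Finset.sum_congr rfl fun i _ => ?_
        rw [mul_left_comm, h1]; ring
    _ = L x y * 0 := by rw [hL.sum_angular hq]; simp

theorem smooth_contraction (hb : IsLocalHVector U L b) : SmoothOn U (contraction b) := by
  have h : ∀ i : Fin n, ContDiffOn ℝ ∞ (fun p : Coord n × Coord n => p.2 i) U :=
    fun i => ContDiff.contDiffOn (by fun_prop)
  change ContDiffOn ℝ ∞ (fun p : Coord n × Coord n => ∑ i, Function.uncurry (b i) p * p.2 i) U
  exact ContDiffOn.sum fun i _ => (hb.smooth i).mul (h i)

theorem fderiv_contraction (hb : IsLocalHVector U L b) (hU : IsOpen U) (hq : (x, y) ∈ U)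
    (w : Coord n × Coord n) :
    fderiv ℝ (Function.uncurry (contraction b)) (x, y) w =
      ∑ i, (y i * fderiv ℝ (Function.uncurry (b i)) (x, y) w + b i x y * w.2 i) := by
  have h : HasFDerivAt (Function.uncurry (contraction b)) _ (x, y) :=
    HasFDerivAt.fun_sum (u := Finset.univ) fun i _ =>
      ((hb.smooth i).differentiableAt hU hq).hasFDerivAt.mul
      (((EuclideanSpace.proj (𝕜 := ℝ) i).comp
        (ContinuousLinearMap.snd ℝ (Coord n) (Coord n))).hasFDerivAt)
  rw [h.fderiv]
  simp [Function.uncurry]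
  exact Finset.sum_congr rfl fun i _ => by ring

theorem dx_contraction (hb : IsLocalHVector U L b) (hU : IsOpen U) (hq : (x, y) ∈ U)
    (k : Fin n) : dx k (contraction b) x y = ∑ i, y i * dx k (b i) x y := by
  rw [dx_eq_fderiv (hb.smooth_contraction.differentiableAt hU hq), hb.fderiv_contraction hU hq]
  refine Finset.sum_congr rfl fun i _ => ?_
  rw [dx_eq_fderiv ((hb.smooth i).differentiableAt hU hq)]
  simp

/-- The dependence of b on direction contributes yⁱ ∂b_i/∂yᵏ = 0, so β differentiates in y as if it
were a one-form on the base. -/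
theorem dy_contraction (hb : IsLocalHVector U L b) (hL : IsLocalFinsler U L) (hq : (x, y) ∈ U)
    (k : Fin n) : dy k (contraction b) x y = b k x y := by
  have hU := hL.isOpen
  rw [dy_eq_fderiv (hb.smooth_contraction.differentiableAt hU hq), hb.fderiv_contraction hU hq,
    Finset.sum_add_distrib]
  simp only [← dy_eq_fderiv ((hb.smooth _).differentiableAt hU hq)]
  rw [hb.sum_dy hL hq]
  simp

/-- The Euler-Lagrange expression of `β` along the spray of `L` is `2 F_{i0}`. -/
theorem sum_skewF (hb : IsLocalHVector U L b) (hL : IsLocalFinsler U L) (hq : (x, y) ∈ U)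
    (i : Fin n) :
    2 * ∑ j, skewF L b i j x y * y j =
      eulerLagrange (contraction b) x y (-(2 : ℝ) • sprayVec L x y)
        (EuclideanSpace.single i 1) := by
  have hU := hL.isOpen
  have hc : ∀ u v, (u, v) ∈ U → dy i (contraction b) u v = b i u v :=
    fun u v h => hb.dy_contraction hL h i
  rw [eulerLagrange_single hb.smooth_contraction hU hq]
  simp only [dx_congr hU hq hc, dy_congr hU hq hc]
  have hd := (hb.smooth i).differentiableAt hU hq
  rw [← fderiv_fst_eq_sum hd, ← fderiv_snd_eq_sum hd, ← apply_eq_fst_add_snd,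
    ← hL.sum_horiz hq (hb.smooth i), hb.dx_contraction hU hq]
  -- The connection terms cancel in the skew part because the Cartan coefficients are symmetric in
  -- their lower indices.
  have h1 : ∀ j, 2 * (skewF L b i j x y * y j) =
      horiz L j (b i) x y * y j - horiz L i (b j) x y * y j := by
    intro j
    have : ∑ r, b r x y * cartanConn L r i j x y = ∑ r, b r x y * cartanConn L r j i x y :=
      Finset.sum_congr rfl fun r _ => by rw [hL.cartanConn_symm hq]
    rw [skewF, hCov, hCov, this]; ring
  -- The terms in N drop out since yʲ ∂b_j/∂yʳ = 0.
  have h2 : ∑ j, horiz L i (b j) x y * y j = ∑ j, y j * dx i (b j) x y := by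
    simp only [horiz, sub_mul, Finset.sum_sub_distrib, Finset.sum_mul]
    rw [Finset.sum_comm]
    have : ∀ r, ∑ j, nonlinConn L r i x y * dy r (b j) x y * y j = 0 := by
      intro r
      rw [← mul_zero (nonlinConn L r i x y), ← hb.sum_dy hL hq r, Finset.mul_sum]
      exact Finset.sum_congr rfl fun j _ => by ring
    simp only [this, Finset.sum_const_zero, sub_zero]
    exact Finset.sum_congr rfl fun j _ => mul_comm _ _
  rw [Finset.mul_sum, Finset.sum_congr rfl fun j _ => h1 j, Finset.sum_sub_distrib, h2]

/-- The spray of `L` solves the Euler-Lagrange equation of `K = L² / β` exactly where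
`F_{i0} = (β_0 / β) m_i`. -/
theorem eulerLagrange_kropina_iff (hb : IsLocalHVector U L b) (hL : IsLocalFinsler U L)
    (hK : SmoothOn U K) (hβ : ∀ x y, (x, y) ∈ U → 0 < contraction b x y)
    (hKL : ∀ x y, (x, y) ∈ U → K x y = L x y ^ 2 / contraction b x y) (hq : (x, y) ∈ U) :
    (∀ v, eulerLagrange K x y (-(2 : ℝ) • sprayVec L x y) v = 0) ↔
      ∀ i, ∑ j, skewF L b i j x y * y j =
        (∑ j, horiz L j (contraction b) x y * y j) / contraction b x y *
          (b i x y - contraction b x y / L x y * supp L i x y) := by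
  have hU := hL.isOpen
  have hB := hb.smooth_contraction
  -- Working with L² = Kβ instead of K = L²/β requires only the product rule for the Euler-Lagrange
  -- expression.
  have hprod : ∀ p ∈ U, Function.uncurry (fun x y => L x y * L x y) p =
      Function.uncurry (fun x y => K x y * contraction b x y) p := by
    rintro ⟨u, v⟩ hp
    have := (hβ u v hp).ne'
    simp only [Function.uncurry, hKL u v hp]
    field_simp
  have hev : ∀ p ∈ U, fderiv ℝ (Function.uncurry (fun x y => L x y * L x y)) p =
      fderiv ℝ (Function.uncurry (fun x y => K x y * contraction b x y)) p := fun p hp =>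
    Filter.EventuallyEq.fderiv_eq
      (by filter_upwards [hU.mem_nhds hp] with p' hp' using hprod p' hp')
  have hEL : ∀ a v, eulerLagrange (fun x y => L x y * L x y) x y a v =
      eulerLagrange (fun x y => K x y * contraction b x y) x y a v := by
    intro a v
    have h2 : fderiv ℝ (fderiv ℝ (Function.uncurry (fun x y => L x y * L x y))) (x, y) =
        fderiv ℝ (fderiv ℝ (Function.uncurry (fun x y => K x y * contraction b x y))) (x, y) :=
      Filter.EventuallyEq.fderiv_eq
        (by filter_upwards [hU.mem_nhds hq] with p' hp' using hev p' hp')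
    rw [eulerLagrange, eulerLagrange, hess, hess, h2, hev _ hq]
  rw [hL.sum_horiz hq hB]
  set a := -(2 : ℝ) • sprayVec L x y with ha
  have hβ0 := hβ x y hq
  have hL0 := hL.pos x y hq
  have hK0 : K x y * contraction b x y = L x y ^ 2 := by
    rw [hKL x y hq]; field_simp
  have hder : ∀ w, fderiv ℝ (Function.uncurry fun x y => L x y * L x y) (x, y) w = _ :=
    fun w => fderiv_mul_uncurry hL.smooth hL.smooth hU hq w
  simp only [hev _ hq, fderiv_mul_uncurry hK hB hU hq] at hder
  have hDL : fderiv ℝ (Function.uncurry L) (x, y) (y, a) = 0 := hL.fderiv_sprayVec hq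
  have hy := hder (y, a)
  rw [hDL] at hy
  -- The central identity β² E_K = -2L² (F_{i0} - (β_0/β) m_i) along the spray of `L`.
  have key : ∀ i, contraction b x y ^ 2 *
      eulerLagrange K x y a (EuclideanSpace.single i 1) = -(2 * L x y ^ 2) *
      (∑ j, skewF L b i j x y * y j -
        fderiv ℝ (Function.uncurry (contraction b)) (x, y) (y, a) / contraction b x y *
          (b i x y - contraction b x y / L x y * supp L i x y)) := by
    intro i
    have h1 := hEL a (EuclideanSpace.single i 1)
    rw [eulerLagrange_mul hL.smooth hL.smooth hU hq, eulerLagrange_mul hK hB hU hq,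
      hL.eulerLagrange_sprayVec hq, hDL, ← hb.sum_skewF hL hq] at h1
    have h2 := hder (0, EuclideanSpace.single i 1)
    rw [← dy_eq_fderiv (hB.differentiableAt hU hq), ← dy_eq_fderiv (hK.differentiableAt hU hq),
      ← dy_eq_fderiv (hL.smooth.differentiableAt hU hq), hb.dy_contraction hL hq] at h2
    rw [← dy_eq_fderiv (hB.differentiableAt hU hq), ← dy_eq_fderiv (hK.differentiableAt hU hq),
      hb.dy_contraction hL hq] at h1
    simp only [supp]
    field_simp
    generalize eulerLagrange K x y a (EuclideanSpace.single i 1) = X at *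
    generalize fderiv ℝ (Function.uncurry (contraction b)) (x, y) (y, a) = B' at *
    generalize fderiv ℝ (Function.uncurry K) (x, y) (y, a) = K' at *
    generalize ∑ j, skewF L b i j x y * y j = F at *
    generalize contraction b x y = B at *
    generalize L x y = l at *
    generalize K x y = k at *
    generalize dy i L x y = li at *
    generalize dy i K x y = ki at *
    generalize b i x y = bi at *
    -- `h1` is the product rule for E, `hy` eliminates the derivative of K along the spray, `h2`
    -- eliminates ∂K/∂yⁱ, and `hK0` replaces Kβ by L².
    linear_combination -B ^ 2 * h1 - 2 * F * B * hK0 - B * bi * hy - B * B' * h2 +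
      2 * bi * B' * hK0
  constructor
  · intro h i
    have h1 := key i
    rw [h, mul_zero] at h1
    have h2 : -(2 * L x y ^ 2) ≠ 0 := by nlinarith
    exact sub_eq_zero.1 ((mul_eq_zero.1 h1.symm).resolve_left h2)
  · intro h v
    rw [eulerLagrange_eq_sum]
    refine Finset.sum_eq_zero fun i _ => ?_
    have h1 := key i
    rw [h, sub_self, mul_zero] at h1
    rw [(mul_eq_zero.1 h1).resolve_left (pow_ne_zero 2 hβ0.ne'), mul_zero]

end IsLocalHVector
end Kropina

/-! ### Change of coordinates -/

section CoordinateChange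

variable {n : ℕ} {W : Set (Coord n)} {φ : Coord n → Coord n}

/-- The prolongation `(x, y) ↦ (φ x, Dφ(x) y)` of a coordinate change. -/
def prolong {n : ℕ} (φ : Coord n → Coord n) (p : Coord n × Coord n) : Coord n × Coord n :=
  (φ p.1, fderiv ℝ φ p.1 p.2)

/-- The second-order term comes from the dependence of Dφ on the base point. With (u, w) = (y, a) it
gives the transformation law of accelerations. -/
theorem hasFDerivAt_prolong (hW : IsOpen W) (hφ : ContDiffOn ℝ ∞ φ W) {p : Coord n × Coord n}
    (hp : p.1 ∈ W) :
    ∃ T : Coord n × Coord n →L[ℝ] Coord n × Coord n, HasFDerivAt (prolong φ) T p ∧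
      ∀ u w, T (u, w) =
        (fderiv ℝ φ p.1 u, fderiv ℝ (fderiv ℝ φ) p.1 u p.2 + fderiv ℝ φ p.1 w) := by
  have h1 : HasFDerivAt φ (fderiv ℝ φ p.1) p.1 :=
    ((hφ.contDiffAt (hW.mem_nhds hp)).differentiableAt (by simp)).hasFDerivAt
  have h2 : HasFDerivAt (fderiv ℝ φ) (fderiv ℝ (fderiv ℝ φ) p.1) p.1 :=
    (((hφ.fderiv_of_isOpen (m := ∞) hW (by simp)).contDiffAt
      (hW.mem_nhds hp)).differentiableAt (by simp)).hasFDerivAt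
  refine ⟨_, (h1.comp p hasFDerivAt_fst).prodMk
    ((h2.comp p hasFDerivAt_fst).clm_apply hasFDerivAt_snd), fun u w => ?_⟩
  simp [add_comm]

/-- The Euler-Lagrange expression is a covector. -/
theorem eulerLagrange_prolong (hW : IsOpen W) (hφ : ContDiffOn ℝ ∞ φ W)
    {U U' : Set (Coord n × Coord n)} (hU : IsOpen U) (hU' : IsOpen U') {f f' : LocalFun n}
    (hf' : SmoothOn U' f') (hUW : ∀ p ∈ U, p.1 ∈ W) (hUU' : ∀ p ∈ U, prolong φ p ∈ U')
    (hff' : ∀ p ∈ U, Function.uncurry f p = Function.uncurry f' (prolong φ p))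
    {x y : Coord n} (hq : (x, y) ∈ U) (a v : Coord n) :
    eulerLagrange f x y a v = eulerLagrange f' (φ x) (fderiv ℝ φ x y)
      (fderiv ℝ (fderiv ℝ φ) x y y + fderiv ℝ φ x a) (fderiv ℝ φ x v) := by
  have hDf : ∀ p ∈ U, ∀ u w, fderiv ℝ (Function.uncurry f) p (u, w) =
      fderiv ℝ (Function.uncurry f') (prolong φ p)
        (fderiv ℝ φ p.1 u, fderiv ℝ (fderiv ℝ φ) p.1 u p.2 + fderiv ℝ φ p.1 w) := by
    intro p hp u w
    obtain ⟨T, hT, hT'⟩ := hasFDerivAt_prolong hW hφ (hUW p hp)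
    have h1 := (hf'.differentiableAt hU' (hUU' p hp)).hasFDerivAt.comp p hT
    have h2 : Function.uncurry f =ᶠ[𝓝 p] Function.uncurry f' ∘ prolong φ := by
      filter_upwards [hU.mem_nhds hp] with r hr using hff' r hr
    rw [h2.fderiv_eq, h1.fderiv, ContinuousLinearMap.comp_apply, hT']
  have hf : SmoothOn U f := by
    have hφ' : ContDiffOn ℝ ∞ (prolong φ) U := by
      have h1 : ContDiffOn ℝ ∞ (fun p : Coord n × Coord n => φ p.1) U :=
        hφ.comp contDiffOn_fst hUW
      have h2 : ContDiffOn ℝ ∞ (fun p : Coord n × Coord n => fderiv ℝ φ p.1) U :=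
        (hφ.fderiv_of_isOpen (m := ∞) hW (by simp)).comp contDiffOn_fst hUW
      exact h1.prodMk (h2.clm_apply contDiffOn_snd)
    exact (ContDiffOn.comp hf' hφ' hUU').congr hff'
  obtain ⟨T, hT, hT'⟩ := hasFDerivAt_prolong hW hφ (hUW _ hq)
  -- The non-tensorial terms D²φ(y, v), from the derivative of the momentum, and D²φ(v, y), from the
  -- position derivative, cancel by this symmetry.
  have hsym : fderiv ℝ (fderiv ℝ φ) x y v = fderiv ℝ (fderiv ℝ φ) x v y :=
    (hφ.contDiffAt (hW.mem_nhds (hUW _ hq))).isSymmSndFDerivAt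
      (by simpa using WithTop.coe_le_coe.2 (le_top (a := (2 : ℕ∞)))) y v
  have hDφ : HasFDerivAt (fun p : Coord n × Coord n => fderiv ℝ φ p.1)
      ((fderiv ℝ (fderiv ℝ φ) x).comp (ContinuousLinearMap.fst ℝ _ _)) (x, y) := by
    have h2 : HasFDerivAt (fderiv ℝ φ) (fderiv ℝ (fderiv ℝ φ) x) x :=
      (((hφ.fderiv_of_isOpen (m := ∞) hW (by simp)).contDiffAt
        (hW.mem_nhds (hUW _ hq))).differentiableAt (by simp)).hasFDerivAt
    exact HasFDerivAt.comp (x, y) (f := Prod.fst) h2 hasFDerivAt_fst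
  have h3 : HasFDerivAt (fun p : Coord n × Coord n => ((0, fderiv ℝ φ p.1 v) : Coord n × Coord n))
      _ (x, y) := (hasFDerivAt_const (0 : Coord n) (x, y)).prodMk
      (hDφ.clm_apply (hasFDerivAt_const v (x, y)))
  have h4 := (((hf'.differentiableAt_fderiv hU' (hUU' _ hq)).hasFDerivAt.comp (x, y) hT).clm_apply
    h3)
  have h5 : (fun p => fderiv ℝ (Function.uncurry f) p (0, v)) =ᶠ[𝓝 (x, y)]
      fun p => fderiv ℝ (Function.uncurry f') (prolong φ p) (0, fderiv ℝ φ p.1 v) := by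
    filter_upwards [hU.mem_nhds hq] with p hp
    simpa using hDf p hp 0 v
  have h6 := congrArg (fun S => S (y, a)) (h5.fderiv_eq.trans h4.fderiv)
  rw [eulerLagrange, hess_eq_fderiv_apply hf hU hq, eulerLagrange, hDf _ hq, h6]
  simp only [map_zero, add_zero]
  simp [hT', hess, prolong, hsym]
  rw [apply_eq_fst_add_snd _ (fderiv ℝ φ x v)]
  ring

end CoordinateChange

/-! ### Coordinates on the tangent bundle -/

section Charts

variable {n : ℕ} {M : Type*} [TopologicalSpace M] [ChartedSpace (EuclideanSpace ℝ (Fin n)) M]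
  {e e' : OpenPartialHomeomorph M (EuclideanSpace ℝ (Fin n))}

theorem tangentMap_congr_of_eventuallyEq {N : Type*} [TopologicalSpace N] {V : Type*}
    [NormedAddCommGroup V] [NormedSpace ℝ V] {H : Type*} [TopologicalSpace H]
    {I : ModelWithCorners ℝ V H} [ChartedSpace H N] {f g : N → M} {p : TangentBundle I N}
    (h : f =ᶠ[𝓝 p.proj] g) : tangentMap I (𝓡 n) f p = tangentMap I (𝓡 n) g p := by
  refine Bundle.TotalSpace.ext h.eq_of_nhds ?_
  rw [tangentMap, tangentMap, h.mfderiv_eq]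
  exact HEq.rfl

theorem coordFun_beta (e : OpenPartialHomeomorph M (EuclideanSpace ℝ (Fin n)))
    (b : (p : TangentBundle (𝓡 n) M) → (TangentSpace (𝓡 n) p.proj →L[ℝ] ℝ)) :
    coordFun e (beta b) = contraction (coordCovec e b) := by
  funext x y
  have h := apply_eq_sum ((b (chartVec e x y)).comp (mfderiv (𝓡 n) (𝓡 n) e.symm x)) y
  refine h.trans (Finset.sum_congr rfl fun i _ => ?_)
  rw [mul_comm]; rfl

theorem chartVec_smul (e : OpenPartialHomeomorph M (EuclideanSpace ℝ (Fin n))) (x y : Coord n)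
    (c : ℝ) : chartVec e x (c • y) = ⟨(chartVec e x y).proj, c • (chartVec e x y).snd⟩ := by
  simp only [chartVec, tangentMap]
  congr 1
  exact map_smul (mfderiv (𝓡 n) (𝓡 n) e.symm x) c y

theorem IsHVector.isLocalHVector {D : Set (TangentBundle (𝓡 n) M)}
    {L : TangentBundle (𝓡 n) M → ℝ}
    {b : (p : TangentBundle (𝓡 n) M) → (TangentSpace (𝓡 n) p.proj →L[ℝ] ℝ)}
    (hb : IsHVector D L b) (he : e ∈ IsManifold.maximalAtlas (𝓡 n) ∞ M) :
    IsLocalHVector (coordDomain e D) (coordFun e L) (coordCovec e b) where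
  smooth := hb.smooth e he
  vParallel := hb.vParallel e he
  exists_rho := by
    obtain ⟨ρ, -, hρ⟩ := hb.exists_rho
    exact ⟨coordFun e ρ, hρ e he⟩

theorem contDiffOn_transition (he : e ∈ IsManifold.maximalAtlas (𝓡 n) ∞ M)
    (he' : e' ∈ IsManifold.maximalAtlas (𝓡 n) ∞ M) :
    ContDiffOn ℝ ∞ (e' ∘ e.symm) (e.symm.trans e').source :=
  contMDiffOn_iff_contDiffOn.1 ((contMDiffOn_of_mem_maximalAtlas he').comp
    ((contMDiffOn_symm_of_mem_maximalAtlas he).mono fun x hx => by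
      simpa using (show x ∈ e.target ∧ _ by simpa using hx).1)
    fun x hx => (show _ ∧ e.symm x ∈ e'.source by simpa using hx).2)

theorem contMDiff_mk_tangentBundle : ContMDiff 𝓘(ℝ, Coord n × Coord n) (𝓡 n).tangent ∞
    (fun q : Coord n × Coord n => (⟨q.1, q.2⟩ : TangentBundle (𝓡 n) (Coord n))) := by
  intro q
  rw [Bundle.contMDiffAt_totalSpace]
  constructor
  · exact contDiff_fst.contMDiff.contMDiffAt
  · simp only [trivializationAt_model_space_apply]
    exact contDiff_snd.contMDiff.contMDiffAt

/-- The chain rule for e⁻¹ = e'⁻¹ ∘ (e' ∘ e⁻¹) near x: coordinates of tangent vectors change by the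
prolongation of the transition map. -/
theorem chartVec_transition (he : e ∈ IsManifold.maximalAtlas (𝓡 n) ∞ M)
    (he' : e' ∈ IsManifold.maximalAtlas (𝓡 n) ∞ M) {x : Coord n}
    (hx : x ∈ (e.symm.trans e').source) (y : Coord n) :
    chartVec e x y = chartVec e' ((e' ∘ e.symm) x) (fderiv ℝ (e' ∘ e.symm) x y) := by
  have hopen := (e.symm.trans e').open_source
  have hx' : x ∈ e.target ∧ e.symm x ∈ e'.source := by simpa using hx
  have hev : e.symm =ᶠ[𝓝 x] e'.symm ∘ (e' ∘ e.symm) := by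
    filter_upwards [hopen.mem_nhds hx] with u hu
    have hu' : u ∈ e.target ∧ e.symm u ∈ e'.source := by simpa using hu
    simp [hu'.2]
  have hφ : DifferentiableAt ℝ (e' ∘ e.symm) x :=
    ((contDiffOn_transition he he').contDiffAt (hopen.mem_nhds hx)).differentiableAt (by simp)
  have hs : MDifferentiableAt (𝓡 n) (𝓡 n) e'.symm ((e' ∘ e.symm) x) :=
    ((contMDiffOn_symm_of_mem_maximalAtlas he').contMDiffAt
      (e'.open_target.mem_nhds (e'.map_source hx'.2))).mdifferentiableAt (by simp)
  rw [chartVec, tangentMap_congr_of_eventuallyEq (p := ⟨x, y⟩) hev,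
    tangentMap_comp_at ⟨x, y⟩ hs hφ.mdifferentiableAt, chartVec]
  congr 1
  simp only [tangentMap, mfderiv_eq_fderiv]
  rfl

theorem velocity_eq_chartVec (he : e ∈ IsManifold.maximalAtlas (𝓡 n) ∞ M) {c : ℝ → M} {t : ℝ}
    (hc : ContMDiffAt 𝓘(ℝ, ℝ) (𝓡 n) 1 c t) (ht : c t ∈ e.source) :
    velocity c t = chartVec e (e (c t)) (deriv (fun r => e (c r)) t) := by
  have hev : c =ᶠ[𝓝 t] e.symm ∘ (e ∘ c) := by
    filter_upwards [hc.continuousAt.eventually (e.open_source.mem_nhds ht)] with u hu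
    exact (e.left_inv hu).symm
  have h1 : MDifferentiableAt (𝓡 n) (𝓡 n) e (c t) :=
    ((contMDiffOn_of_mem_maximalAtlas he).contMDiffAt
      (e.open_source.mem_nhds ht)).mdifferentiableAt (by simp)
  have hs : MDifferentiableAt (𝓡 n) (𝓡 n) e.symm ((e ∘ c) t) :=
    ((contMDiffOn_symm_of_mem_maximalAtlas he).contMDiffAt
      (e.open_target.mem_nhds (e.map_source ht))).mdifferentiableAt (by simp)
  have h2 : MDifferentiableAt 𝓘(ℝ, ℝ) (𝓡 n) (e ∘ c) t :=
    h1.comp t (hc.mdifferentiableAt (by simp))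
  rw [velocity, tangentMap_congr_of_eventuallyEq (p := ⟨t, (1 : ℝ)⟩) hev,
    tangentMap_comp_at ⟨t, (1 : ℝ)⟩ hs h2, chartVec]
  congr 1
  simp only [tangentMap, mfderiv_eq_fderiv]
  congr 1

variable [IsManifold (𝓡 n) ∞ M]

theorem contMDiffOn_chartVec (he : e ∈ IsManifold.maximalAtlas (𝓡 n) ∞ M) :
    ContMDiffOn 𝓘(ℝ, Coord n × Coord n) (𝓡 n).tangent ∞
      (fun q : Coord n × Coord n => chartVec e q.1 q.2) (e.target ×ˢ Set.univ) := by
  have h1 := (contMDiffOn_symm_of_mem_maximalAtlas he).contMDiffOn_tangentMapWithin (m := ∞)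
    (by simp) e.open_target.uniqueMDiffOn
  refine (h1.comp (contMDiff_mk_tangentBundle (n := n)).contMDiffOn fun _ hq => hq.1).congr
    fun q hq => ?_
  have h2 : MDifferentiableAt (𝓡 n) (𝓡 n) e.symm q.1 :=
    ((contMDiffOn_symm_of_mem_maximalAtlas he).contMDiffAt
      (e.open_target.mem_nhds hq.1)).mdifferentiableAt (by simp)
  exact (tangentMapWithin_eq_tangentMap (p := ⟨q.1, q.2⟩)
    (e.open_target.uniqueMDiffOn _ hq.1) h2).symm

theorem isOpen_coordDomain (he : e ∈ IsManifold.maximalAtlas (𝓡 n) ∞ M)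
    {D : Set (TangentBundle (𝓡 n) M)} (hD : IsOpen D) : IsOpen (coordDomain e D) := by
  have := (contMDiffOn_chartVec he).continuousOn.isOpen_inter_preimage
    (e.open_target.prod isOpen_univ) hD
  convert this using 1
  ext q
  simp [coordDomain]

theorem smoothOn_coordFun (he : e ∈ IsManifold.maximalAtlas (𝓡 n) ∞ M)
    {D : Set (TangentBundle (𝓡 n) M)} {L : TangentBundle (𝓡 n) M → ℝ}
    (hL : ContMDiffOn (𝓡 n).tangent 𝓘(ℝ, ℝ) ∞ L D) : SmoothOn (coordDomain e D) (coordFun e L) :=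
  contMDiffOn_iff_contDiffOn.1 (hL.comp ((contMDiffOn_chartVec he).mono
    fun _ (hq : _ ∈ coordDomain e D) => ⟨hq.1, trivial⟩) fun _ hq => hq.2)

theorem IsFinslerMetric.isLocalFinsler {D : Set (TangentBundle (𝓡 n) M)}
    {L : TangentBundle (𝓡 n) M → ℝ} (hL : IsFinslerMetric D L)
    (he : e ∈ IsManifold.maximalAtlas (𝓡 n) ∞ M) :
    IsLocalFinsler (coordDomain e D) (coordFun e L) where
  isOpen := isOpen_coordDomain he hL.isOpen
  conic x y hq c hc := ⟨hq.1, by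
    change chartVec e x (c • y) ∈ D
    rw [chartVec_smul]; exact hL.conic _ hq.2 c hc⟩
  smooth := smoothOn_coordFun he hL.smooth
  pos x y hq := hL.pos _ hq.2
  homogeneous x y hq c hc := by
    rw [coordFun, chartVec_smul, hL.homogeneous _ hq.2 c hc, pow_one]; rfl
  nondegenerate := hL.nondegenerate e he

end Charts

/-! ### Geodesics -/

section Geodesics

theorem hasDerivAt_deriv_of_contDiffAt {V : Type*} [NormedAddCommGroup V] [NormedSpace ℝ V]
    {X : ℝ → V} {t : ℝ} (hX : ContDiffAt ℝ 2 X t) :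
    HasDerivAt (deriv X) (deriv (deriv X) t) t := by
  have h1 : ContDiffAt ℝ 1 (fderiv ℝ X) t := hX.fderiv_right (by norm_num)
  have h2 : DifferentiableAt ℝ (fun r => fderiv ℝ X r 1) t :=
    (h1.differentiableAt (by simp)).clm_apply (differentiableAt_const _)
  exact h2.hasDerivAt

theorem eventually_hasDerivAt_of_contDiffAt {V : Type*} [NormedAddCommGroup V] [NormedSpace ℝ V]
    {X : ℝ → V} {t : ℝ} (hX : ContDiffAt ℝ 2 X t) : ∀ᶠ r in 𝓝 t, HasDerivAt X (deriv X r) r := by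
  filter_upwards [hX.eventually (by simp)] with r hr
  exact (hr.differentiableAt (by simp)).hasDerivAt

variable {n : ℕ} {M : Type*} [TopologicalSpace M] [ChartedSpace (EuclideanSpace ℝ (Fin n)) M]
  {e e' : OpenPartialHomeomorph M (EuclideanSpace ℝ (Fin n))}

theorem contDiffAt_coord_comp (he : e ∈ IsManifold.maximalAtlas (𝓡 n) ∞ M) {c : ℝ → M} {t : ℝ}
    (hc : ContMDiffAt 𝓘(ℝ, ℝ) (𝓡 n) 2 c t) (ht : c t ∈ e.source) :
    ContDiffAt ℝ 2 (fun r => e (c r)) t := by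
  have h1 : ContMDiffAt (𝓡 n) (𝓡 n) 2 e (c t) :=
    ((contMDiffOn_of_mem_maximalAtlas he).contMDiffAt
      (e.open_source.mem_nhds ht)).of_le (WithTop.coe_le_coe.2 (le_top (a := (2 : ℕ∞))))
  exact contMDiffAt_iff_contDiffAt.1 (h1.comp t hc)

variable {D : Set (TangentBundle (𝓡 n) M)} {L : TangentBundle (𝓡 n) M → ℝ} {c : ℝ → M} {t : ℝ}

theorem mem_coordDomain_of_velocity (he : e ∈ IsManifold.maximalAtlas (𝓡 n) ∞ M)
    (hc : ContMDiffAt 𝓘(ℝ, ℝ) (𝓡 n) 2 c t) (ht : c t ∈ e.source) (hv : velocity c t ∈ D) :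
    (e (c t), deriv (fun r => e (c r)) t) ∈ coordDomain e D :=
  ⟨e.map_source ht, by
    rw [velocity_eq_chartVec he (hc.of_le (by norm_num)) ht] at hv; exact hv⟩

variable [IsManifold (𝓡 n) ∞ M]

/-- In a chart, the geodesic equation is the Euler-Lagrange equation. -/
theorem geodesic_equation_iff (hL : IsFinslerMetric D L)
    (he : e ∈ IsManifold.maximalAtlas (𝓡 n) ∞ M)
    (hc : ContMDiffAt 𝓘(ℝ, ℝ) (𝓡 n) 2 c t) (ht : c t ∈ e.source) (hv : velocity c t ∈ D) :
    (∀ i, deriv (deriv fun r => e (c r)) t i +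
        2 * spray (coordFun e L) i (e (c t)) (deriv (fun r => e (c r)) t) =
      deriv (fun r => L (velocity c r)) t / L (velocity c t) * deriv (fun r => e (c r)) t i) ↔
    ∀ v, eulerLagrange (coordFun e L) (e (c t)) (deriv (fun r => e (c r)) t)
      (deriv (deriv fun r => e (c r)) t) v = 0 := by
  have hF := hL.isLocalFinsler he
  have hq := mem_coordDomain_of_velocity he hc ht hv
  have hX := contDiffAt_coord_comp he hc ht
  have hM : IsManifold (𝓡 n) 2 M := .of_le (WithTop.coe_le_coe.2 (le_top (a := (2 : ℕ∞))))
  -- Expressing ds/dt in the chart near t identifies d²s/dt² with the derivative of `L` in the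
  -- direction (velocity, acceleration).
  have hvel : (fun r => L (velocity c r)) =ᶠ[𝓝 t] fun r =>
      Function.uncurry (coordFun e L) (e (c r), deriv (fun r => e (c r)) r) := by
    filter_upwards [(contMDiffAt_iff_contMDiffAt_nhds (by simp)).1 hc,
      hc.continuousAt.eventually (e.open_source.mem_nhds ht)] with r hr hr'
    rw [velocity_eq_chartVec he (hr.of_le (by norm_num)) hr']; rfl
  have hX1 := (eventually_hasDerivAt_of_contDiffAt hX).self_of_nhds
  have hd := (hF.smooth.differentiableAt hF.isOpen hq).hasFDerivAt.comp_hasDerivAt t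
    (f := fun r => (e (c r), deriv (fun r => e (c r)) r))
    (hX1.prodMk (hasDerivAt_deriv_of_contDiffAt hX))
  rw [← hF.add_sprayVec_eq_iff hq, hvel.deriv_eq,
    show L (velocity c t) = coordFun e L (e (c t)) (deriv (fun r => e (c r)) t) from
      hvel.self_of_nhds, show deriv (fun r => Function.uncurry (coordFun e L)
        (e (c r), deriv (fun r => e (c r)) r)) t = _ from hd.deriv]
  constructor
  · intro h
    ext i
    simpa [sprayVec] using h i
  · intro h i
    simpa [sprayVec] using congrArg (fun w : Coord n => w i) h

/-- The Euler-Lagrange equation along a curve does not depend on the chart. -/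
theorem eulerLagrange_eq_zero_of_chart (hL : IsFinslerMetric D L)
    (he : e ∈ IsManifold.maximalAtlas (𝓡 n) ∞ M) (he' : e' ∈ IsManifold.maximalAtlas (𝓡 n) ∞ M)
    (hc : ContMDiffAt 𝓘(ℝ, ℝ) (𝓡 n) 2 c t) (ht : c t ∈ e.source) (ht' : c t ∈ e'.source)
    (hv : velocity c t ∈ D)
    (h : ∀ v, eulerLagrange (coordFun e L) (e (c t)) (deriv (fun r => e (c r)) t)
      (deriv (deriv fun r => e (c r)) t) v = 0) (v : Coord n) :
    eulerLagrange (coordFun e' L) (e' (c t)) (deriv (fun r => e' (c r)) t)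
      (deriv (deriv fun r => e' (c r)) t) v = 0 := by
  set W := (e'.symm.trans e).source with hWdef
  set ψ : Coord n → Coord n := e ∘ e'.symm with hψ
  have hW : IsOpen W := (e'.symm.trans e).open_source
  have hψs : ContDiffOn ℝ ∞ ψ W := contDiffOn_transition he' he
  have hF := hL.isLocalFinsler he
  have hF' := hL.isLocalFinsler he'
  have hmemW : ∀ r, c r ∈ e.source → c r ∈ e'.source → e' (c r) ∈ W := by
    intro r h1 h2
    simp [hWdef, h1, h2]
  have hψe : ∀ r, c r ∈ e'.source → ψ (e' (c r)) = e (c r) := by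
    intro r h1
    simp [hψ, h1]
  have hev : ∀ᶠ r in 𝓝 t, c r ∈ e.source ∧ c r ∈ e'.source :=
    (hc.continuousAt.eventually (e.open_source.mem_nhds ht)).and
      (hc.continuousAt.eventually (e'.open_source.mem_nhds ht'))
  have hX' := contDiffAt_coord_comp he' hc ht'
  have hψd : ∀ r, c r ∈ e.source → c r ∈ e'.source →
      HasFDerivAt ψ (fderiv ℝ ψ (e' (c r))) (e' (c r)) := fun r h1 h2 =>
    ((hψs.contDiffAt (hW.mem_nhds (hmemW r h1 h2))).differentiableAt (by simp)).hasFDerivAt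
  -- The velocity law is needed on a neighbourhood of t so that it can be differentiated once more
  -- to compare accelerations.
  have hd1 : deriv (fun r => e (c r)) =ᶠ[𝓝 t]
      fun r => fderiv ℝ ψ (e' (c r)) (deriv (fun r => e' (c r)) r) := by
    filter_upwards [hev.eventually_nhds, eventually_hasDerivAt_of_contDiffAt hX'] with r hr hr'
    have h1 := (hψd r hr.self_of_nhds.1 hr.self_of_nhds.2).comp_hasDerivAt r hr'
    refine (h1.congr_of_eventuallyEq ?_).deriv
    filter_upwards [hr] with s hs using (hψe s hs.2).symm
  have hψ2 : HasFDerivAt (fderiv ℝ ψ) (fderiv ℝ (fderiv ℝ ψ) (e' (c t))) (e' (c t)) :=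
    (((hψs.fderiv_of_isOpen (m := ∞) hW (by simp)).contDiffAt
      (hW.mem_nhds (hmemW t ht ht'))).differentiableAt (by simp)).hasFDerivAt
  have hX1 := (eventually_hasDerivAt_of_contDiffAt hX').self_of_nhds
  have hd2 := hd1.deriv_eq.trans ((HasFDerivAt.comp_hasDerivAt t (f := fun r => e' (c r))
    hψ2 hX1).clm_apply (hasDerivAt_deriv_of_contDiffAt hX')).deriv
  have hq' := mem_coordDomain_of_velocity he' hc ht' hv
  have key := eulerLagrange_prolong hW hψs
    (U := coordDomain e' D ∩ Prod.fst ⁻¹' W) (U' := coordDomain e D)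
    (hF'.isOpen.inter (hW.preimage continuous_fst)) hF.isOpen (f := coordFun e' L) hF.smooth
    (fun p hp => hp.2)
    (fun p hp => by
      have h2 : p.1 ∈ e'.target ∧ e'.symm p.1 ∈ e.source := by simpa [hWdef] using hp.2
      refine ⟨e.map_source h2.2, ?_⟩
      have h1 := hp.1.2
      rw [chartVec_transition he' he hp.2] at h1
      exact h1)
    (fun p hp => congrArg L (chartVec_transition he' he hp.2 p.2))
    (x := e' (c t)) (y := deriv (fun r => e' (c r)) t) ⟨hq', hmemW t ht ht'⟩
    (deriv (deriv fun r => e' (c r)) t) v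
  have hd1' : deriv (fun r => e (c r)) t =
      fderiv ℝ ψ (e' (c t)) (deriv (fun r => e' (c r)) t) := hd1.self_of_nhds
  have h1 := h (fderiv ℝ ψ (e' (c t)) v)
  rw [hd2, hd1'] at h1
  rw [key, hψe t ht']
  exact h1

theorem isGeodesic_iff (hL : IsFinslerMetric D L) {J : Set ℝ} (hJ : IsOpen J) :
    IsGeodesic D L c J ↔ ContMDiffOn 𝓘(ℝ, ℝ) (𝓡 n) 2 c J ∧ (∀ t ∈ J, velocity c t ∈ D) ∧
      ∀ e ∈ IsManifold.maximalAtlas (𝓡 n) ∞ M, ∀ t ∈ J, c t ∈ e.source → ∀ v,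
        eulerLagrange (coordFun e L) (e (c t)) (deriv (fun r => e (c r)) t)
          (deriv (deriv fun r => e (c r)) t) v = 0 := by
  constructor
  · rintro ⟨h1, h2, h3⟩
    exact ⟨h1, h2, fun e he t ht hts => (geodesic_equation_iff hL he
      (h1.contMDiffAt (hJ.mem_nhds ht)) hts (h2 t ht)).1 (h3 e he t ht hts)⟩
  · rintro ⟨h1, h2, h3⟩
    exact ⟨h1, h2, fun e he t ht hts => (geodesic_equation_iff hL he
      (h1.contMDiffAt (hJ.mem_nhds ht)) hts (h2 t ht)).2 (h3 e he t ht hts)⟩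

/-- An integral curve of a smooth vector field is smooth. -/
theorem contDiffOn_of_hasDerivAt {V : Type*} [NormedAddCommGroup V] [NormedSpace ℝ V]
    {X : V → V} {z : ℝ → V} {J : Set ℝ} {U : Set V} (hJ : IsOpen J) (hX : ContDiffOn ℝ ∞ X U)
    (hz : ∀ t ∈ J, HasDerivAt z (X (z t)) t) (hzU : ∀ t ∈ J, z t ∈ U) (k : ℕ) :
    ContDiffOn ℝ k z J := by
  induction k with
  | zero => exact contDiffOn_zero.2 fun t ht => (hz t ht).continuousAt.continuousWithinAt
  | succ k ih =>
    push_cast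
    rw [contDiffOn_succ_iff_deriv_of_isOpen hJ]
    refine ⟨fun t ht => (hz t ht).differentiableAt.differentiableWithinAt, by simp, ?_⟩
    exact ((hX.of_le (by exact_mod_cast le_top)).comp ih hzU).congr fun t ht => (hz t ht).deriv

/-- Through every admissible vector passes a geodesic, whose acceleration in the given chart
is that of the spray. -/
theorem exists_isGeodesic (hL : IsFinslerMetric D L)
    (he : e ∈ IsManifold.maximalAtlas (𝓡 n) ∞ M) {x y : Coord n}
    (hq : (x, y) ∈ coordDomain e D) :
    ∃ (c : ℝ → M) (J : Set ℝ), IsOpen J ∧ J.OrdConnected ∧ 0 ∈ J ∧ IsGeodesic D L c J ∧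
      c 0 ∈ e.source ∧ e (c 0) = x ∧ deriv (fun r => e (c r)) 0 = y ∧
      deriv (deriv fun r => e (c r)) 0 = -(2 : ℝ) • sprayVec (coordFun e L) x y := by
  have hF := hL.isLocalFinsler he
  set U := coordDomain e D with hU
  -- The spray equation x'' = -2G(x, x') as a first-order system on the admissible set.
  set X : Coord n × Coord n → Coord n × Coord n :=
    fun q => (q.2, -(2 : ℝ) • sprayVec (coordFun e L) q.1 q.2) with hXdef
  have hX : ContDiffOn ℝ ∞ X U := contDiffOn_snd.prodMk (hF.smooth_sprayVec.const_smul _)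
  obtain ⟨z, hz0, ε, hε, hz⟩ :=
    ((hX.contDiffAt (hF.isOpen.mem_nhds hq)).of_le
      (by exact_mod_cast le_top)).exists_forall_mem_closedBall_exists_eq_forall_mem_Ioo_hasDerivAt₀
      (0 : ℝ)
  have hzU : ∀ᶠ t in 𝓝 (0 : ℝ), z t ∈ U :=
    (hz 0 (by constructor <;> linarith)).continuousAt.eventually
      (by rw [hz0]; exact hF.isOpen.mem_nhds hq)
  obtain ⟨δ, hδ, hball⟩ := Metric.eventually_nhds_iff_ball.1 hzU
  -- Within ε the differential equation holds; within δ the solution remains admissible.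
  set J := Set.Ioo (0 - min δ ε) (0 + min δ ε) with hJdef
  have hJ : IsOpen J := isOpen_Ioo
  have hmin : 0 < min δ ε := lt_min hδ hε
  have h0 : (0 : ℝ) ∈ J := by constructor <;> linarith
  have hzJ : ∀ t ∈ J, HasDerivAt z (X (z t)) t := fun t ht =>
    hz t ⟨by linarith [ht.1, min_le_right δ ε], by linarith [ht.2, min_le_right δ ε]⟩
  have hUJ : ∀ t ∈ J, z t ∈ U := fun t ht => hball t (by
    rw [Metric.mem_ball, Real.dist_eq, abs_lt]
    constructor <;> linarith [ht.1, ht.2, min_le_left δ ε])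
  have hzs : ContDiffOn ℝ 2 z J := contDiffOn_of_hasDerivAt hJ hX hzJ hUJ 2
  set c : ℝ → M := fun t => e.symm (z t).1 with hc
  have hcs : ∀ t ∈ J, c t ∈ e.source := fun t ht => e.map_target (hUJ t ht).1
  have hec : ∀ t ∈ J, e (c t) = (z t).1 := fun t ht => e.right_inv (hUJ t ht).1
  have hcsm : ContMDiffOn 𝓘(ℝ, ℝ) (𝓡 n) 2 c J :=
    ((contMDiffOn_symm_of_mem_maximalAtlas he).of_le
      (WithTop.coe_le_coe.2 (le_top (a := (2 : ℕ∞))))).comp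
      (contMDiffOn_iff_contDiffOn.2 hzs.fst) fun t ht => (hUJ t ht).1
  have hd1 : ∀ t ∈ J, deriv (fun r => e (c r)) t = (z t).2 := fun t ht => by
    have h1 : HasDerivAt (fun r => (z r).1) (z t).2 t := (hzJ t ht).fst
    refine (h1.congr_of_eventuallyEq ?_).deriv
    filter_upwards [hJ.mem_nhds ht] with r hr using hec r hr
  have hd2 : ∀ t ∈ J, deriv (deriv fun r => e (c r)) t =
      -(2 : ℝ) • sprayVec (coordFun e L) (z t).1 (z t).2 := fun t ht => by
    have h1 : HasDerivAt (fun r => (z r).2)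
      (-(2 : ℝ) • sprayVec (coordFun e L) (z t).1 (z t).2) t := (hzJ t ht).snd
    refine (h1.congr_of_eventuallyEq ?_).deriv
    filter_upwards [hJ.mem_nhds ht] with r hr using hd1 r hr
  have hct : ∀ t ∈ J, ContMDiffAt 𝓘(ℝ, ℝ) (𝓡 n) 2 c t := fun t ht =>
    hcsm.contMDiffAt (hJ.mem_nhds ht)
  have hvel : ∀ t ∈ J, velocity c t ∈ D := fun t ht => by
    rw [velocity_eq_chartVec he ((hct t ht).of_le (by norm_num)) (hcs t ht), hec t ht, hd1 t ht]
    exact (hUJ t ht).2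
  refine ⟨c, J, hJ, Set.ordConnected_Ioo, h0, (isGeodesic_iff hL hJ).2 ⟨hcsm, hvel, ?_⟩,
    hcs 0 h0, ?_, ?_, ?_⟩
  · intro e' he' t ht hts
    refine eulerLagrange_eq_zero_of_chart hL he he' (hct t ht) (hcs t ht) hts (hvel t ht) ?_
    rw [hec t ht, hd1 t ht, hd2 t ht]
    exact hF.eulerLagrange_sprayVec (hUJ t ht)
  · rw [hec 0 h0, hz0]
  · rw [hd1 0 h0, hz0]
  · rw [hd2 0 h0, hz0]

/-- A change of metric is projective if and only if the spray of the first metric solves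
the Euler-Lagrange equation of the second one. -/
theorem isProjectiveChange_iff {K : TangentBundle (𝓡 n) M → ℝ} (hL : IsFinslerMetric D L)
    (hK : IsFinslerMetric D K) :
    IsProjectiveChange D L K ↔ ∀ e ∈ IsManifold.maximalAtlas (𝓡 n) ∞ M, ∀ x y,
      (x, y) ∈ coordDomain e D → ∀ v,
        eulerLagrange (coordFun e K) x y (-(2 : ℝ) • sprayVec (coordFun e L) x y) v = 0 := by
  constructor
  · intro h e he x y hq
    obtain ⟨c, J, hJ, hJc, h0, hg, hs, hx, hy, ha⟩ := exists_isGeodesic hL he hq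
    have h1 := ((isGeodesic_iff hK hJ).1 ((h c J hJ hJc).1 hg)).2.2 e he 0 h0 hs
    rwa [hx, hy, ha] at h1
  · intro h c J hJ _
    rw [isGeodesic_iff hL hJ, isGeodesic_iff hK hJ]
    -- Regularity and admissibility do not involve the metric, so only the equations are compared,
    -- at each parameter value and in each chart.
    refine and_congr_right fun h1 => and_congr_right fun h2 => ?_
    refine forall₂_congr fun e he => forall₂_congr fun t ht => forall_congr' fun hts => ?_
    have hq := mem_coordDomain_of_velocity he (h1.contMDiffAt (hJ.mem_nhds ht)) hts (h2 t ht)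
    exact (hL.isLocalFinsler he).eulerLagrange_iff_of_sprayVec (hK.isLocalFinsler he) hq
      (h e he _ _ hq) _

end Geodesics

end KropinaChange

end

theorem theorem4p1 {n : ℕ} {M : Type*} [TopologicalSpace M]
    [ChartedSpace (EuclideanSpace ℝ (Fin n)) M] [IsManifold (𝓡 n) ∞ M]
    (D : Set (TangentBundle (𝓡 n) M)) (L : TangentBundle (𝓡 n) M → ℝ)
    (b : (p : TangentBundle (𝓡 n) M) → (TangentSpace (𝓡 n) p.proj →L[ℝ] ℝ))
    (hL : KropinaChange.IsFinslerMetric D L)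
    (hb : KropinaChange.IsHVector D L b)
    (hK : KropinaChange.IsFinslerMetric D (KropinaChange.kropina L b)) :
    KropinaChange.IsProjectiveChange D L (KropinaChange.kropina L b) ↔
      ∀ e ∈ IsManifold.maximalAtlas (𝓡 n) ∞ M,
        ∀ x y, (x, y) ∈ KropinaChange.coordDomain e D → ∀ i : Fin n,
          ∑ j, KropinaChange.skewF (KropinaChange.coordFun e L)
              (KropinaChange.coordCovec e b) i j x y * y j =
            (∑ j, KropinaChange.horiz (KropinaChange.coordFun e L) j
                (KropinaChange.coordFun e (KropinaChange.beta b)) x y * y j) /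
              KropinaChange.coordFun e (KropinaChange.beta b) x y *
              KropinaChange.coordM e L b i x y := by
  rw [KropinaChange.isProjectiveChange_iff hL hK]
  refine forall₂_congr fun e he => forall₂_congr fun x y => forall_congr' fun hq => ?_
  -- Positivity of β is forced by that of L²/β and of L.
  have hβ : ∀ x y, (x, y) ∈ KropinaChange.coordDomain e D →
      0 < KropinaChange.contraction (KropinaChange.coordCovec e b) x y := by
    intro x y hq
    rw [← KropinaChange.coordFun_beta]
    have h1 := hK.pos _ hq.2
    have h2 := hL.pos _ hq.2
    exact (div_pos_iff_of_pos_left (pow_pos h2 2)).1 h1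
  rw [(hb.isLocalHVector he).eulerLagrange_kropina_iff (hL.isLocalFinsler he)
    (hK.isLocalFinsler he).smooth hβ (fun x y _ => by rw [← KropinaChange.coordFun_beta]; rfl) hq,
    KropinaChange.coordFun_beta]
  simp only [KropinaChange.coordM, KropinaChange.coordFun_beta]
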